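/- Let $S^1=\mathbb R/\mathbb Z$ and let $f:S^1\times\mathbb R\to\mathbb R$ be smooth and proper, with $\lim_{x\to+\infty}f(t,x)=\lim_{x\to-\infty}f(t,x)=+\infty$ for every $t\in S^1$, and with $D_2^2f(t,x)>0$ for all $(t,x)$, where $D_2$ is the partial derivative in the second variable. Let $(B^1,B^0)$ be either of the pairs of real Banach spaces $(C^1(S^1),C^0(S^1))$ or $(H^1(S^1),L^2(S^1))$ of real-valued functions, where $H^1(S^1)$ is the space of absolutely continuous functions on $S^1$ with derivative in $L^2$. Let $\tilde B^0=\{v\in B^0:\int_{S^1}v=0\}$, and let $F:B^1\to B^0$ be the operator $F(u)(t)=u'(t)+f(t,u(t))$. Then, in both cases, $F$ is a global fold: there are ($C^\infty$) diffeomorphisms $\Xi_1:B^1\to\mathbb R\times\tilde B^0$ and $\Xi_0:B^0\to\mathbb R\times\tilde B^0$ such that $$(\Xi_0\circ F\circ\Xi_1^{-1})(x,\tilde v)=(x^2,\tilde v)\qquad\text{for all }(x,\tilde v)\in\mathbb R\times\tilde B^0 .$$ -/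

import Mathlib

open MeasureTheory Filter Topology
open scoped Manifold ContDiff

noncomputable section

namespace PeriodicODE

/-! The circle is `UnitAddCircle = ℝ / ℤ`, whose `volume` has total mass one. -/

/-- Smoothness of a function on the cylinder: its lift to `ℝ × ℝ`, one-periodic in the first
variable, is smooth. -/
def SmoothOnCylinder (f : UnitAddCircle × ℝ → ℝ) : Prop :=
  ContDiff ℝ ∞ (fun p : ℝ × ℝ => f ((p.1 : UnitAddCircle), p.2))

/-- The second partial derivative in the second variable. -/
def D₂D₂ (f : UnitAddCircle × ℝ → ℝ) (t : UnitAddCircle) (x : ℝ) : ℝ :=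
  iteratedDeriv 2 (fun y => f (t, y)) x

/-! ### Spaces of continuous functions -/

/-- `C⁰(S¹)` with the supremum norm. -/
abbrev C0 : Type := C(UnitAddCircle, ℝ)

/-- `C¹(S¹)`, a function `u` being recorded as the pair `(u, u')`; the norm is the `C¹` norm
`max ‖u‖_∞ ‖u'‖_∞`. -/
def C1 : Submodule ℝ (C0 × C0) where
  carrier := {p | ∀ t : ℝ, HasDerivAt (fun s : ℝ => p.1 (s : UnitAddCircle)) (p.2 t) t}
  add_mem' hp hq t := (hp t).add (hq t)
  zero_mem' t := hasDerivAt_const t (0 : ℝ)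
  smul_mem' c _ hp t := (hp t).const_mul c

/-- Continuous functions of average zero. -/
def C0Tilde : Submodule ℝ C0 where
  carrier := {v | ∫ t, v t = 0}
  add_mem' {v w} hv hw := by
    have hiv : Integrable v := v.continuous.integrable_of_hasCompactSupport
      (HasCompactSupport.of_compactSpace _)
    have hiw : Integrable w := w.continuous.integrable_of_hasCompactSupport
      (HasCompactSupport.of_compactSpace _)
    simp only [Set.mem_ofPred_eq] at hv hw ⊢
    simp [integral_add hiv hiw, hv, hw]
  zero_mem' := by simp
  smul_mem' c v hv := by
    simp only [Set.mem_ofPred_eq] at hv ⊢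
    simp [integral_const_mul, hv]

/-- The operator `u ↦ u' + f(t, u(t))` from `C¹(S¹)` to `C⁰(S¹)`. -/
def opC (f : C(UnitAddCircle × ℝ, ℝ)) (u : C1) : C0 :=
  u.1.2 + f.comp ((ContinuousMap.id UnitAddCircle).prodMk u.1.1)

/-! ### Hilbert spaces -/

/-- `H⁰(S¹) = L²(S¹)`. -/
abbrev H0 : Type := Lp ℝ 2 (volume : Measure UnitAddCircle)

lemma H0.intervalIntegrable (w : H0) {x : ℝ} (hx : x ∈ Set.Icc (0 : ℝ) 1) :
    IntervalIntegrable (fun s : ℝ => w (s : UnitAddCircle)) volume 0 x := by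
  have h1 : Integrable w := (Lp.memLp w).integrable (by norm_num)
  have h2 := (UnitAddCircle.measurePreserving_mk 0).integrable_comp_of_integrable h1
  rw [intervalIntegrable_iff_integrableOn_Ioc_of_le hx.1]
  refine IntegrableOn.mono_set h2 (Set.Ioc_subset_Ioc_right ?_)
  simpa using hx.2

lemma H0.integral_congr {g h : UnitAddCircle → ℝ} (e : g =ᵐ[volume] h) {x : ℝ}
    (hx : x ∈ Set.Icc (0 : ℝ) 1) :
    ∫ s in (0 : ℝ)..x, g (s : UnitAddCircle) = ∫ s in (0 : ℝ)..x, h (s : UnitAddCircle) := by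
  have h2 := (UnitAddCircle.measurePreserving_mk 0).quasiMeasurePreserving.ae_eq_comp e
  rw [intervalIntegral.integral_of_le hx.1, intervalIntegral.integral_of_le hx.1]
  refine integral_congr_ae (ae_mono (Measure.restrict_mono_set _ ?_) h2)
  exact Set.Ioc_subset_Ioc_right (by simpa using hx.2)

/-- `H¹(S¹)`, with its Hilbert space structure `⟨u, v⟩ = ⟨u, v⟩_{L²} + ⟨u', v'⟩_{L²}`. A function `u`
is recorded as the pair `(u, u')` of elements of `L²`; membership says that `u` has a
representative `U` on the circle that is absolutely continuous with derivative `u'`, that is,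
`U` is continuous and `U x = U 0 + ∫₀ˣ u'`. -/
def H1 : Submodule ℝ (WithLp 2 (H0 × H0)) where
  carrier := {p | ∃ U : C(UnitAddCircle, ℝ), p.fst =ᵐ[volume] U ∧
    ∀ x ∈ Set.Icc (0 : ℝ) 1,
      U (x : UnitAddCircle) = U ((0 : ℝ) : UnitAddCircle)
        + ∫ s in (0 : ℝ)..x, p.snd (s : UnitAddCircle)}
  add_mem' := by
    rintro p q ⟨U, hU, hU'⟩ ⟨V, hV, hV'⟩
    refine ⟨U + V, ?_, fun x hx => ?_⟩
    · rw [WithLp.add_fst]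
      filter_upwards [Lp.coeFn_add p.fst q.fst, hU, hV] with t h1 h2 h3
      rw [h1, Pi.add_apply, h2, h3, ContinuousMap.add_apply]
    · rw [WithLp.add_snd, H0.integral_congr (Lp.coeFn_add p.snd q.snd) hx]
      simp only [Pi.add_apply, ContinuousMap.add_apply]
      rw [intervalIntegral.integral_add (H0.intervalIntegrable _ hx) (H0.intervalIntegrable _ hx),
        hU' x hx, hV' x hx]
      ring
  zero_mem' := by
    refine ⟨0, ?_, fun x hx => ?_⟩
    · exact Lp.coeFn_zero ℝ 2 volume
    · rw [WithLp.zero_snd, H0.integral_congr (Lp.coeFn_zero ℝ 2 volume) hx]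
      simp
  smul_mem' := by
    rintro c p ⟨U, hU, hU'⟩
    refine ⟨c • U, ?_, fun x hx => ?_⟩
    · rw [WithLp.smul_fst]
      filter_upwards [Lp.coeFn_smul c p.fst, hU] with t h1 h2
      simp [h1, h2]
    · rw [WithLp.smul_snd, H0.integral_congr (Lp.coeFn_smul c p.snd) hx]
      simp only [Pi.smul_apply, ContinuousMap.smul_apply, smul_eq_mul]
      rw [intervalIntegral.integral_const_mul, hU' x hx]
      ring

/-- Square integrable functions of average zero. -/
def H0Tilde : Submodule ℝ H0 where
  carrier := {v | ∫ t, v t = 0}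
  add_mem' {v w} hv hw := by
    have hiv : Integrable v := (Lp.memLp v).integrable (by norm_num)
    have hiw : Integrable w := (Lp.memLp w).integrable (by norm_num)
    simp only [Set.mem_ofPred_eq] at hv hw ⊢
    rw [integral_congr_ae (Lp.coeFn_add v w)]
    simp [integral_add hiv hiw, hv, hw]
  zero_mem' := by
    simp only [Set.mem_ofPred_eq]
    rw [integral_congr_ae (Lp.coeFn_zero ℝ 2 volume)]
    simp
  smul_mem' c v hv := by
    simp only [Set.mem_ofPred_eq] at hv ⊢
    rw [integral_congr_ae (Lp.coeFn_smul c v)]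
    simp [integral_const_mul, hv]

lemma H1.memLp_comp (f : C(UnitAddCircle × ℝ, ℝ)) (u : H1) :
    MemLp (fun t : UnitAddCircle => f (t, u.1.fst t)) 2 volume := by
  obtain ⟨U, hU, -⟩ := u.2
  have hc : MemLp (f.comp ((ContinuousMap.id UnitAddCircle).prodMk U)) 2
      (volume : Measure UnitAddCircle) :=
    (ContinuousMap.continuous _).memLp_of_hasCompactSupport (HasCompactSupport.of_compactSpace _)
  refine hc.ae_eq ?_
  filter_upwards [hU] with t ht
  simp [ht]

/-- The operator `u ↦ u' + f(t, u(t))` from `H¹(S¹)` to `L²(S¹)`. -/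
def opH (f : C(UnitAddCircle × ℝ, ℝ)) (u : H1) : H0 :=
  u.1.snd + (H1.memLp_comp f u).toLp (fun t : UnitAddCircle => f (t, u.1.fst t))

/-! ### Global folds -/

/-- `G : B₁ → B₀` is a global fold (with respect to the subspace `Z` of `B₀`): smooth
diffeomorphisms of `B₁` and of `B₀` onto `ℝ × Z` conjugate `G` to `(x, v) ↦ (x², v)`. -/
def IsGlobalFold {B₁ B₀ : Type*} [NormedAddCommGroup B₁] [NormedSpace ℝ B₁]
    [NormedAddCommGroup B₀] [NormedSpace ℝ B₀] (Z : Submodule ℝ B₀) (G : B₁ → B₀) : Prop :=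
  ∃ (Ξ₁ : B₁ ≃ₘ[ℝ] (ℝ × Z)) (Ξ₀ : B₀ ≃ₘ[ℝ] (ℝ × Z)),
    ∀ (x : ℝ) (v : Z), Ξ₀ (G (Ξ₁.symm (x, v))) = (x ^ 2, v)

end PeriodicODE

end

/-!
Write `Q g` for the primitive of `g - ∫ g` vanishing at `0`. Integrating once, `u' + f(·, u) = v`
splits into `u + Q f(·, u) = u(0) + Q v` and `∫ f(·, u) = ∫ v`. Since `Q` is compact and `f` is
coercive, `Φ u = u + Q f(·, u)` is a smooth diffeomorphism of `C⁰`: uniqueness for scalar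
differential equations makes `Φ` and its derivatives injective, and its range is open and closed.
Give `u` the coordinates `(s, w)`, with `w` mean-free, for which `Φ u = s + Q w`. Then the mean-free
part of `v` is `w`, and its mean is `c(s) = ∫ f(·, u_s)`, where `u_s` runs through the curve
`Φ(u_s) = s + e`, `e = Q w`.

The first variation `h` of `u_s` solves `h' + D₂f h = const` with `h(0) = h(1) = 1`, hence is
positive; the second variation then shows `c'' > 0`. As `c` is also coercive, it is a square up to
an additive constant after a change of variable depending smoothly on `e`. The pairs `(C¹, C⁰)` and
`(H¹, L²)` differ only in the linear coordinates `u ↦ (u(0), u')` and `v ↦ (∫ v, v - ∫ v)`.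
-/

noncomputable section

namespace PeriodicODE

/-! ### Integrals depending smoothly on a parameter -/

section ParametricIntegral

universe u v

variable {E : Type u} [NormedAddCommGroup E] [NormedSpace ℝ E] {F : Type v}
  [NormedAddCommGroup F] [NormedSpace ℝ F] {a b : ℝ}

theorem hasFDerivAt_intervalIntegral_of_contDiff {G : E × ℝ → F} (hG : ContDiff ℝ 1 G) (e : E) :
    HasFDerivAt (fun e => ∫ τ in a..b, G (e, τ))
      (∫ τ in a..b, (fderiv ℝ G (e, τ)).comp (ContinuousLinearMap.inl ℝ E ℝ)) e := by
  have hG' : Continuous fun p : E × ℝ =>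
      (fderiv ℝ G p).comp (ContinuousLinearMap.inl ℝ E ℝ) :=
    (hG.continuous_fderiv one_ne_zero).clm_comp continuous_const
  have hslice (x : E) : Continuous fun τ : ℝ => (x, τ) := by fun_prop
  obtain ⟨M, hM⟩ := (isCompact_uIcc (a := a) (b := b)).exists_bound_of_continuousOn
    (hG'.comp (hslice e)).continuousOn
  obtain ⟨u, v, hu, -, heu, hv, huv⟩ := generalized_tube_lemma (isCompact_singleton (x := e))
    (isCompact_uIcc (a := a) (b := b))
    (isOpen_lt hG'.norm (continuous_const (y := M + 1))) (by
      rintro ⟨x, τ⟩ ⟨rfl, hτ⟩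
      exact (hM τ hτ).trans_lt (lt_add_one M))
  refine intervalIntegral.hasFDerivAt_integral_of_dominated_of_fderiv_le
    (F' := fun x τ => (fderiv ℝ G (x, τ)).comp (ContinuousLinearMap.inl ℝ E ℝ))
    (bound := fun _ => M + 1) (hu.mem_nhds (heu rfl))
    (.of_forall fun x => (hG.continuous.comp (hslice x)).aestronglyMeasurable)
    ((hG.continuous.comp (hslice e)).intervalIntegrable _ _)
    (hG'.comp (hslice e)).aestronglyMeasurable
    (.of_forall fun τ hτ x hx => ?_) intervalIntegrable_const (.of_forall fun τ _ x _ => ?_)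
  · exact (huv ⟨hx, hv (Set.uIoc_subset_uIcc hτ)⟩ : _ < _).le
  · exact (hG.differentiable one_ne_zero (x, τ)).hasFDerivAt.comp x (hasFDerivAt_prodMk_left x τ)

theorem contDiff_intervalIntegral {n : ℕ∞} {G : E × ℝ → F} (hG : ContDiff ℝ n G) :
    ContDiff ℝ n fun e => ∫ τ in a..b, G (e, τ) := by
  -- The derivative takes values in `E →L[ℝ] F`, so the induction needs a universe containing `E`.
  suffices h : ∀ (m : ℕ) {F' : Type (max u v)} [NormedAddCommGroup F'] [NormedSpace ℝ F']
      {G' : E × ℝ → F'}, ContDiff ℝ m G' → ContDiff ℝ m fun e => ∫ τ in a..b, G' (e, τ) by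
    let up : F ≃L[ℝ] ULift.{u} F := ContinuousLinearEquiv.ulift.symm
    have hup : (fun e => ∫ τ in a..b, G (e, τ)) =
        fun e => up.symm (∫ τ in a..b, up (G (e, τ))) := by
      ext e
      simp only [intervalIntegral, up.integral_comp_comm, ← map_sub, up.symm_apply_apply]
    rw [hup]
    exact contDiff_iff_forall_nat_le.2 fun m hm =>
      up.symm.contDiff.comp (h m (up.contDiff.comp (hG.of_le (mod_cast hm))))
  intro m
  induction m with
  | zero =>
    intro F' _ _ G' hG'
    exact contDiff_zero.2 (intervalIntegral.continuous_parametric_intervalIntegral_of_continuous'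
      (f := fun e τ => G' (e, τ)) hG'.continuous a b)
  | succ m ih =>
    intro F' _ _ G' hG'
    refine contDiff_succ_iff_hasFDerivAt.2 ⟨_, ?_,
      hasFDerivAt_intervalIntegral_of_contDiff (hG'.of_le (mod_cast Nat.le_add_left 1 m))⟩
    exact ih (G' := fun p => (fderiv ℝ G' p).comp (ContinuousLinearMap.inl ℝ E ℝ))
      ((hG'.fderiv_right le_rfl).clm_comp contDiff_const)

end ParametricIntegral

/-! ### Fold normal form of a convex coercive function of one variable and parameters -/

/-- The diffeomorphism of normed spaces given by an equivalence that is smooth in both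
directions. -/
def diffeomorphOfContDiff {E F : Type*} [NormedAddCommGroup E] [NormedSpace ℝ E]
    [NormedAddCommGroup F] [NormedSpace ℝ F] (e : E ≃ F) (he : ContDiff ℝ ∞ e)
    (he' : ContDiff ℝ ∞ e.symm) : E ≃ₘ[ℝ] F where
  toEquiv := e
  contMDiff_toFun := he.contMDiff
  contMDiff_invFun := he'.contMDiff

theorem taylor_integral_remainder_two {g g₁ g₂ : ℝ → ℝ} (h₁ : ∀ s, HasDerivAt g (g₁ s) s)
    (h₂ : ∀ s, HasDerivAt g₁ (g₂ s) s) (hg₂ : Continuous g₂) (a s : ℝ) :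
    g s = g a + (s - a) * g₁ a
      + (s - a) ^ 2 * ∫ τ in (0 : ℝ)..1, (1 - τ) * g₂ (a + τ * (s - a)) := by
  let γ : ℝ → ℝ := fun τ => a + τ * (s - a)
  have hγ (τ) : HasDerivAt γ (s - a) τ :=
    (((hasDerivAt_id τ).mul_const (s - a)).const_add a).congr_deriv (one_mul _)
  have hψ (τ : ℝ) : HasDerivAt (fun τ => (1 - τ) * (g₁ (γ τ) * (s - a)) + g (γ τ))
      ((s - a) ^ 2 * ((1 - τ) * g₂ (γ τ))) τ := by
    refine ((((hasDerivAt_id τ).const_sub 1).mul (((h₂ (γ τ)).comp τ (hγ τ)).mul_const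
      (s - a))).add ((h₁ (γ τ)).comp τ (hγ τ))).congr_deriv ?_
    simp only [id_eq, Function.comp_apply]
    ring
  have hint := intervalIntegral.integral_eq_sub_of_hasDerivAt (a := 0) (b := 1) (fun τ _ => hψ τ)
    (Continuous.intervalIntegrable (by fun_prop) _ _)
  rw [intervalIntegral.integral_const_mul] at hint
  rw [hint]
  simp only [sub_self, one_mul, add_sub_cancel, zero_mul, zero_add, sub_zero, add_zero, γ]
  ring

section Fold

variable {E : Type*}

/-- The partial derivative of `c` in its first, real, variable. -/
def partialFst (c : ℝ × E → ℝ) (p : ℝ × E) : ℝ :=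
  deriv (fun s => c (s, p.2)) p.1

theorem strictMono_of_partialFst_pos {g : ℝ × E → ℝ} (hpos : ∀ p, 0 < partialFst g p)
    (e : E) : StrictMono fun s => g (s, e) :=
  strictMono_of_deriv_pos fun s => hpos (s, e)

variable [NormedAddCommGroup E] [NormedSpace ℝ E] {c g : ℝ × E → ℝ}

theorem hasDerivAt_partialFst (hc : ContDiff ℝ ∞ c) (s : ℝ) (e : E) :
    HasDerivAt (fun s => c (s, e)) (partialFst c (s, e)) s :=
  ((hc.differentiable (by simp)).comp (f := fun s : ℝ => (s, e)) (by fun_prop) s).hasDerivAt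

theorem contDiff_partialFst (hc : ContDiff ℝ ∞ c) : ContDiff ℝ ∞ (partialFst c) := by
  have h : partialFst c = fun p => fderiv ℝ c p (1, 0) := by
    ext ⟨s, e⟩
    exact ((hc.differentiable (by simp) (s, e)).hasFDerivAt.comp_hasDerivAt s
      ((hasDerivAt_id s).prodMk (hasDerivAt_const s e))).deriv
  rw [h]
  exact (hc.fderiv_right (m := ∞) (by simp)).clm_apply contDiff_const

theorem contDiff_of_forall_eq_zero [CompleteSpace E] (hg : ContDiff ℝ ∞ g)
    (hpos : ∀ p, 0 < partialFst g p) {σ : E → ℝ} (hσ : ∀ e, g (σ e, e) = 0) :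
    ContDiff ℝ ∞ σ := by
  refine contDiff_iff_contDiffAt.2 fun e => ?_
  let G : E × ℝ → ℝ := fun p => g (p.2, p.1)
  have hG : ContDiff ℝ ∞ G := hg.comp (contDiff_snd.prodMk contDiff_fst)
  have hGe := hG.contDiffAt (x := (e, σ e))
  have hG' : partialFst g (σ e, e) = fderiv ℝ G (e, σ e) (0, 1) :=
    (hasDerivAt_partialFst hg (σ e) e).unique ((hG.differentiable (by simp)
      (e, σ e)).hasFDerivAt.comp_hasDerivAt (σ e)
        ((hasDerivAt_const (σ e) e).prodMk (hasDerivAt_id (σ e))))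
  have hinv : ((fderiv ℝ G (e, σ e)) ∘L ContinuousLinearMap.inr ℝ E ℝ).IsInvertible := by
    refine ⟨ContinuousLinearEquiv.unitsEquivAut ℝ (Units.mk0 _ (hpos (σ e, e)).ne'), ?_⟩
    ext
    simp [hG']
  refine (hGe.contDiffAt_implicitFunction (by simp) hinv).congr_of_eventuallyEq ?_
  filter_upwards [hGe.eventually_apply_implicitFunction (by simp) hinv] with x hx
  refine (strictMono_of_partialFst_pos hpos x).injective ?_
  simpa only [G, hσ] using hx.symm

theorem exists_diffeomorph_of_partialFst_pos [CompleteSpace E] (hg : ContDiff ℝ ∞ g)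
    (hpos : ∀ p, 0 < partialFst g p) (hsurj : ∀ e, Function.Surjective fun s => g (s, e)) :
    ∃ X : (ℝ × E) ≃ₘ[ℝ] (ℝ × E), ∀ p, X p = (g p, p.2) := by
  choose σ hσ using fun p : ℝ × E => hsurj p.2 p.1
  let X : (ℝ × E) ≃ (ℝ × E) :=
    { toFun p := (g p, p.2)
      invFun p := (σ p, p.2)
      left_inv p := Prod.ext ((strictMono_of_partialFst_pos hpos p.2).injective (hσ _)) rfl
      right_inv p := Prod.ext (hσ p) rfl }
  have hσ' : ContDiff ℝ ∞ σ := by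
    let k : ℝ × (ℝ × E) → ℝ := fun p => g (p.1, p.2.2) - p.2.1
    have hk : ContDiff ℝ ∞ k := by fun_prop
    refine contDiff_of_forall_eq_zero hk (fun p => ?_) fun p => sub_eq_zero.2 (hσ p)
    have hkg : partialFst k p = partialFst g (p.1, p.2.2) :=
      deriv_sub_const (f := fun s => g (s, p.2.2)) p.2.1
    exact hkg ▸ hpos _
  exact ⟨diffeomorphOfContDiff X (hg.prodMk contDiff_snd) (hσ'.prodMk contDiff_snd), fun _ => rfl⟩

theorem exists_contDiff_partialFst_eq_zero [CompleteSpace E] (hc : ContDiff ℝ ∞ c)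
    (hpos : ∀ p, 0 < partialFst (partialFst c) p)
    (htop : ∀ e, Tendsto (fun s => c (s, e)) atTop atTop)
    (hbot : ∀ e, Tendsto (fun s => c (s, e)) atBot atTop) :
    ∃ σ : E → ℝ, ContDiff ℝ ∞ σ ∧ ∀ e, partialFst c (σ e, e) = 0 := by
  have hcrit (e : E) : ∃ s, partialFst c (s, e) = 0 := by
    have hcont : Continuous fun s => c (s, e) := hc.continuous.comp (by fun_prop)
    obtain ⟨s, hs⟩ := hcont.exists_forall_le (by
      rw [cocompact_eq_atBot_atTop]
      exact (hbot e).sup (htop e))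
    exact ⟨s, IsLocalMin.deriv_eq_zero (.of_forall hs)⟩
  choose σ hσ using hcrit
  exact ⟨σ, contDiff_of_forall_eq_zero (contDiff_partialFst hc) hpos hσ, hσ⟩

theorem exists_contDiff_eq_sq_mul_add (hc : ContDiff ℝ ∞ c)
    (hpos : ∀ p, 0 < partialFst (partialFst c) p) {σ : E → ℝ} (hσ : ContDiff ℝ ∞ σ)
    (hcrit : ∀ e, partialFst c (σ e, e) = 0) :
    ∃ q : ℝ × E → ℝ, ContDiff ℝ ∞ q ∧ (∀ p, 0 < q p) ∧
      ∀ p, c p = (p.1 - σ p.2) ^ 2 * q p + c (σ p.2, p.2) := by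
  have hc₁ := contDiff_partialFst hc
  have hc₂ := contDiff_partialFst hc₁
  refine ⟨fun p => ∫ τ in (0 : ℝ)..1,
    (1 - τ) * partialFst (partialFst c) (σ p.2 + τ * (p.1 - σ p.2), p.2), ?_, fun p => ?_, ?_⟩
  · exact contDiff_intervalIntegral (G := fun z : (ℝ × E) × ℝ =>
      (1 - z.2) * partialFst (partialFst c) (σ z.1.2 + z.2 * (z.1.1 - σ z.1.2), z.1.2))
      (by fun_prop)
  · have := hc₂.continuous
    exact intervalIntegral.intervalIntegral_pos_of_pos_on
      (Continuous.intervalIntegrable (by fun_prop) _ _)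
      (fun τ hτ => mul_pos (sub_pos.2 hτ.2) (hpos _)) zero_lt_one
  · rintro ⟨s, e⟩
    have := hc₂.continuous
    rw [taylor_integral_remainder_two (fun s => hasDerivAt_partialFst hc s e)
      (fun s => hasDerivAt_partialFst hc₁ s e) (by fun_prop) (σ e) s, hcrit]
    ring

theorem partialFst_sqrt_mul_pos (hpos : ∀ p, 0 < partialFst (partialFst c) p)
    {σ : E → ℝ} (hσ : ContDiff ℝ ∞ σ) (hcrit : ∀ e, partialFst c (σ e, e) = 0)
    {q : ℝ × E → ℝ} (hq : ContDiff ℝ ∞ q) (hqpos : ∀ p, 0 < q p)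
    (hcq : ∀ p, c p = (p.1 - σ p.2) ^ 2 * q p + c (σ p.2, p.2)) (p : ℝ × E) :
    0 < partialFst (fun p => (p.1 - σ p.2) * √(q p)) p := by
  obtain ⟨s, e⟩ := p
  have hsqrt : ContDiff ℝ ∞ fun p => √(q p) := hq.sqrt fun p => (hqpos p).ne'
  have hξ : ContDiff ℝ ∞ fun p : ℝ × E => (p.1 - σ p.2) * √(q p) := by fun_prop
  have hξ' := hasDerivAt_partialFst hξ s e
  set ξ : ℝ × E → ℝ := fun p => (p.1 - σ p.2) * √(q p) with hξ_def
  rcases eq_or_ne s (σ e) with hs | hs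
  · have h := ((hasDerivAt_id s).sub_const (σ e)).mul (hasDerivAt_partialFst hsqrt s e)
    have h' : partialFst ξ (s, e) = √(q (s, e)) := by
      simpa [hs] using hξ'.unique h
    exact h' ▸ Real.sqrt_pos.2 (hqpos _)
  · have hcξ : (fun s => c (s, e)) = fun s => ξ (s, e) ^ 2 + c (σ e, e) := by
      ext s
      rw [hcq, hξ_def, mul_pow, Real.sq_sqrt (hqpos _).le]
    have hc' : partialFst c (s, e) = 2 * ξ (s, e) * partialFst ξ (s, e) := by
      simpa [partialFst, hcξ] using ((hξ'.pow 2).add_const (c (σ e, e))).deriv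
    have hmono : 0 < (s - σ e) * partialFst c (s, e) := by
      have h := strictMono_of_partialFst_pos hpos e
      rcases hs.lt_or_gt with hs | hs
      · exact mul_pos_of_neg_of_neg (sub_neg.2 hs) ((h hs).trans_eq (hcrit e))
      · exact mul_pos (sub_pos.2 hs) ((hcrit e).symm.trans_lt (h hs))
    have hfactor : (s - σ e) * partialFst c (s, e)
        = 2 * (s - σ e) ^ 2 * √(q (s, e)) * partialFst ξ (s, e) := by
      rw [hc', hξ_def]
      ring
    exact pos_of_mul_pos_right (hfactor ▸ hmono) (by positivity)

theorem exists_fold_coordinate [CompleteSpace E] (hc : ContDiff ℝ ∞ c)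
    (hpos : ∀ p, 0 < partialFst (partialFst c) p)
    (htop : ∀ e, Tendsto (fun s => c (s, e)) atTop atTop)
    (hbot : ∀ e, Tendsto (fun s => c (s, e)) atBot atTop) :
    ∃ (m : E → ℝ) (X : (ℝ × E) ≃ₘ[ℝ] (ℝ × E)), ContDiff ℝ ∞ m ∧
      ∀ p, (X p).2 = p.2 ∧ c p = (X p).1 ^ 2 + m p.2 := by
  obtain ⟨σ, hσ, hcrit⟩ := exists_contDiff_partialFst_eq_zero hc hpos htop hbot
  obtain ⟨q, hq, hqpos, hcq⟩ := exists_contDiff_eq_sq_mul_add hc hpos hσ hcrit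
  let ξ : ℝ × E → ℝ := fun p => (p.1 - σ p.2) * √(q p)
  have hξ : ContDiff ℝ ∞ ξ := by
    have := hq.sqrt fun p => (hqpos p).ne'
    fun_prop
  have hcξ (p) : c p = ξ p ^ 2 + c (σ p.2, p.2) := by
    rw [hcq, mul_pow, Real.sq_sqrt (hqpos p).le]
  have habs {l : Filter ℝ} {e : E} (h : Tendsto (fun s => c (s, e)) l atTop) :
      Tendsto (fun s => |ξ (s, e)|) l atTop := by
    simp_rw [← Real.sqrt_sq_eq_abs]
    refine Real.tendsto_sqrt_atTop.comp ((tendsto_atTop_add_const_right l (-c (σ e, e)) h).congr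
      fun s => ?_)
    rw [hcξ]
    ring
  have hsurj (e : E) : Function.Surjective fun s => ξ (s, e) := by
    refine Continuous.surjective (hξ.continuous.comp (by fun_prop)) ?_ ?_
    · refine (habs (htop e)).congr' ((eventually_ge_atTop (σ e)).mono fun s hs => ?_)
      exact abs_of_nonneg (mul_nonneg (sub_nonneg.2 hs) (Real.sqrt_nonneg _))
    · refine (tendsto_neg_atTop_atBot.comp (habs (hbot e))).congr'
        ((eventually_le_atBot (σ e)).mono fun s hs => ?_)
      exact neg_eq_iff_eq_neg.2 (abs_of_nonpos (mul_nonpos_of_nonpos_of_nonneg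
        (sub_nonpos.2 hs) (Real.sqrt_nonneg _)))
  obtain ⟨X, hX⟩ := exists_diffeomorph_of_partialFst_pos hξ
    (partialFst_sqrt_mul_pos hpos hσ hcrit hq hqpos hcq) hsurj
  refine ⟨fun e => c (σ e, e), X, by fun_prop, fun p => ?_⟩
  rw [hX]
  exact ⟨rfl, hcξ p⟩

end Fold

/-! ### Primitives on the circle -/

theorem isOpenQuotientMap_coe : IsOpenQuotientMap ((↑) : ℝ → UnitAddCircle) :=
  QuotientAddGroup.isOpenQuotientMap_mk

theorem exists_coe_eq (x : UnitAddCircle) : ∃ t ∈ Set.Icc (0 : ℝ) 1, (t : UnitAddCircle) = x := by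
  have h : x ∈ ((↑) : ℝ → UnitAddCircle) '' Set.Icc (0 : ℝ) (0 + 1) := by
    rw [AddCircle.coe_image_Icc_eq]
    trivial
  rwa [zero_add] at h

theorem intervalIntegral_zero_one (g : UnitAddCircle → ℝ) :
    ∫ s in (0 : ℝ)..1, g s = ∫ t, g t := by
  simpa only [zero_add] using UnitAddCircle.intervalIntegral_preimage 0 g

section Primitive

variable {g h : UnitAddCircle → ℝ} (hg : Integrable g) (hh : Integrable h)
include hg

theorem intervalIntegrable_coe (a b : ℝ) :
    IntervalIntegrable (fun s : ℝ => g (s : UnitAddCircle)) volume a b := by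
  have hper : Function.Periodic (fun s : ℝ => g (s : UnitAddCircle)) 1 := fun s => by simp
  refine hper.intervalIntegrable₀ one_ne_zero ?_ a b
  rw [intervalIntegrable_iff_integrableOn_Ioc_of_le zero_le_one]
  simpa [IntegrableOn, Function.comp_def] using
    (UnitAddCircle.measurePreserving_mk 0).integrable_comp_of_integrable hg

/-- The periodic function `t ↦ ∫₀ᵗ g - t ∫ g`, that is, the primitive of the mean-free part of `g`
that vanishes at `0`. -/
def primitiveFun : C0 where
  toFun := Function.Periodic.lift (f := fun t : ℝ => (∫ s in (0 : ℝ)..t, g s) - t * ∫ s, g s)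
    (c := (1 : ℝ)) (fun t => by
      have hper : Function.Periodic (fun s : ℝ => g (s : UnitAddCircle)) 1 := fun s => by simp
      have hadd := hper.intervalIntegral_add_eq_add 0 t fun a b => intervalIntegrable_coe hg a b
      rw [zero_add, intervalIntegral_zero_one] at hadd
      simp only [hadd]
      ring)
  continuous_toFun := isOpenQuotientMap_coe.isQuotientMap.continuous_iff.2
    ((intervalIntegral.continuous_primitive (intervalIntegrable_coe hg) 0).sub (by fun_prop))

theorem primitiveFun_coe (t : ℝ) :
    primitiveFun hg t = (∫ s in (0 : ℝ)..t, g s) - t * ∫ s, g s :=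
  rfl

include hh in
theorem primitiveFun_congr (e : g =ᵐ[volume] h) : primitiveFun hg = primitiveFun hh := by
  ext x
  obtain ⟨t, ht, rfl⟩ := exists_coe_eq x
  rw [primitiveFun_coe, primitiveFun_coe, integral_congr_ae e, H0.integral_congr e ht]

include hh in
theorem primitiveFun_add : primitiveFun (hg.add hh) = primitiveFun hg + primitiveFun hh := by
  ext x
  obtain ⟨t, -, rfl⟩ := exists_coe_eq x
  simp only [ContinuousMap.add_apply, primitiveFun_coe, Pi.add_apply]
  rw [integral_add hg hh, intervalIntegral.integral_add (intervalIntegrable_coe hg _ _)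
    (intervalIntegrable_coe hh _ _)]
  ring

theorem primitiveFun_smul (c : ℝ) : primitiveFun (hg.smul c) = c • primitiveFun hg := by
  ext x
  obtain ⟨t, -, rfl⟩ := exists_coe_eq x
  simp only [ContinuousMap.smul_apply, primitiveFun_coe, Pi.smul_apply, smul_eq_mul,
    integral_const_mul, intervalIntegral.integral_const_mul]
  ring

theorem norm_primitiveFun_le : ‖primitiveFun hg‖ ≤ 2 * ∫ t, ‖g t‖ := by
  refine (ContinuousMap.norm_le _
    (mul_nonneg two_pos.le (integral_nonneg fun _ => norm_nonneg _))).2 fun x => ?_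
  obtain ⟨t, ht, rfl⟩ := exists_coe_eq x
  have hint : ‖∫ s in (0 : ℝ)..t, g s‖ ≤ ∫ t, ‖g t‖ := by
    refine (intervalIntegral.norm_integral_le_integral_norm ht.1).trans ?_
    rw [← intervalIntegral_zero_one fun t => ‖g t‖]
    exact intervalIntegral.integral_mono_interval le_rfl ht.1 ht.2
      (.of_forall fun _ => norm_nonneg _) (intervalIntegrable_coe hg.norm 0 1)
  have hmean : ‖t * ∫ s, g s‖ ≤ 1 * ∫ t, ‖g t‖ := by
    rw [norm_mul, Real.norm_of_nonneg ht.1]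
    exact mul_le_mul ht.2 (norm_integral_le_integral_norm _) (norm_nonneg _) zero_le_one
  rw [primitiveFun_coe]
  linarith [norm_sub_le (∫ s in (0 : ℝ)..t, g s) (t * ∫ s, g s)]

end Primitive

/-- The operator `g ↦ (t ↦ ∫₀ᵗ g - t ∫ g)` from `L¹` to `C⁰`. -/
def primitive : Lp ℝ 1 (volume : Measure UnitAddCircle) →L[ℝ] C0 :=
  LinearMap.mkContinuous
    { toFun g := primitiveFun (L1.integrable_coeFn g)
      map_add' g h := by
        rw [primitiveFun_congr _ ((L1.integrable_coeFn g).add (L1.integrable_coeFn h))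
          (Lp.coeFn_add g h), primitiveFun_add]
      map_smul' c g := by
        rw [primitiveFun_congr _ ((L1.integrable_coeFn g).smul c) (Lp.coeFn_smul c g),
          primitiveFun_smul, RingHom.id_apply] } 2
    fun g => by
      rw [L1.norm_eq_integral_norm]
      exact norm_primitiveFun_le (L1.integrable_coeFn g)

theorem primitive_apply (g : Lp ℝ 1 (volume : Measure UnitAddCircle)) :
    primitive g = primitiveFun (L1.integrable_coeFn g) :=
  rfl

/-- The mean value on `C⁰`. -/
def mean : C0 →L[ℝ] ℝ :=
  L1.integralCLM ∘L ContinuousMap.toLp 1 volume ℝ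

/-- The operator `g ↦ (t ↦ ∫₀ᵗ g - t ∫ g)` on `C⁰`. -/
def meanPrimitive : C0 →L[ℝ] C0 :=
  primitive ∘L ContinuousMap.toLp 1 volume ℝ

theorem integrable_coe (g : C0) : Integrable g :=
  g.continuous.integrable_of_hasCompactSupport (HasCompactSupport.of_compactSpace _)

theorem continuous_coe_comp (g : C0) : Continuous fun s : ℝ => g (s : UnitAddCircle) :=
  g.continuous.comp (AddCircle.continuous_mk' 1)

theorem mean_apply (g : C0) : mean g = ∫ t, g t := by
  rw [mean, ContinuousLinearMap.comp_apply, ← L1.integral_eq, L1.integral_eq_integral]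
  exact integral_congr_ae (ContinuousMap.coeFn_toLp volume g)

theorem mean_one : mean 1 = 1 := by
  simp [mean_apply, Measure.real]

theorem norm_mean_le (g : C0) : ‖mean g‖ ≤ ‖g‖ := by
  rw [mean_apply]
  simpa [Measure.real] using norm_integral_le_of_norm_le_const
    (μ := (volume : Measure UnitAddCircle)) (.of_forall fun x => g.norm_coe_le_norm x)

theorem meanPrimitive_coe (g : C0) (t : ℝ) :
    meanPrimitive g t = (∫ s in (0 : ℝ)..t, g s) - t * mean g := by
  rw [mean_apply, meanPrimitive, ContinuousLinearMap.comp_apply, primitive_apply,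
    primitiveFun_congr _ (integrable_coe g) (ContinuousMap.coeFn_toLp volume g), primitiveFun_coe]

theorem meanPrimitive_apply_zero (g : C0) : meanPrimitive g ((0 : ℝ) : UnitAddCircle) = 0 := by
  rw [meanPrimitive_coe, intervalIntegral.integral_same, zero_mul, sub_zero]

theorem meanPrimitive_apply_one (g : C0) : meanPrimitive g ((1 : ℝ) : UnitAddCircle) = 0 := by
  rw [AddCircle.coe_period, ← QuotientAddGroup.mk_zero, meanPrimitive_apply_zero]

theorem meanPrimitive_one : meanPrimitive 1 = 0 := by
  ext x
  obtain ⟨t, -, rfl⟩ := exists_coe_eq x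
  simp [meanPrimitive_coe, mean_one]

theorem hasDerivAt_meanPrimitive (g : C0) (t : ℝ) :
    HasDerivAt (fun s : ℝ => meanPrimitive g s) (g t - mean g) t := by
  simp only [meanPrimitive_coe]
  exact (((continuous_coe_comp g).integral_hasStrictDerivAt 0 t).hasDerivAt.sub
    ((hasDerivAt_id t).mul_const (mean g))).congr_deriv (by rw [one_mul])

theorem norm_meanPrimitive_sub_le (g : C0) (s t : ℝ) :
    ‖meanPrimitive g s - meanPrimitive g t‖ ≤ 2 * ‖g‖ * ‖s - t‖ := by
  refine convex_univ.norm_image_sub_le_of_norm_hasDerivWithin_le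
    (fun r _ => (hasDerivAt_meanPrimitive g r).hasDerivWithinAt) (fun r _ => ?_) trivial trivial
  linarith [norm_sub_le (g r) (mean g), norm_mean_le g, g.norm_coe_le_norm r]

theorem isCompactOperator_of_equicontinuous {X F : Type*} [TopologicalSpace X] [CompactSpace X]
    [NormedAddCommGroup F] [NormedSpace ℝ F] {T : F →L[ℝ] C(X, ℝ)}
    (hT : Equicontinuous fun (v : Metric.ball (0 : F) 1) x => T v x) : IsCompactOperator T := by
  let e := ContinuousMap.isometryEquivBoundedOfCompact X ℝ
  let A : Set (BoundedContinuousFunction X ℝ) := (fun v => e (T v)) '' Metric.ball 0 1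
  have hA : IsCompact (closure A) := by
    refine BoundedContinuousFunction.arzela_ascoli (Metric.closedBall 0 ‖T‖)
      (isCompact_closedBall _ _) A ?_ fun x U hU => ?_
    · rintro _ x ⟨v, hv, rfl⟩
      have hTv : ‖T v‖ ≤ ‖T‖ * 1 := T.le_opNorm_of_le (mem_ball_zero_iff.1 hv).le
      rw [mem_closedBall_zero_iff]
      exact ((T v).norm_coe_le_norm x).trans (mul_one ‖T‖ ▸ hTv)
    · filter_upwards [hT x U hU] with y hy
      rintro ⟨_, v, hv, rfl⟩
      exact hy ⟨v, hv⟩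
  refine ⟨e.symm '' closure A, hA.image e.symm.continuous, ?_⟩
  filter_upwards [Metric.ball_mem_nhds (0 : F) one_pos] with v hv
  exact ⟨e (T v), subset_closure ⟨v, hv, rfl⟩, e.symm_apply_apply _⟩

theorem isCompactOperator_meanPrimitive : IsCompactOperator meanPrimitive := by
  refine isCompactOperator_of_equicontinuous fun x U hU => ?_
  obtain ⟨t, -, rfl⟩ := exists_coe_eq x
  obtain ⟨ε, hε, hεU⟩ := Metric.mem_uniformity_dist.1 hU
  rw [QuotientAddGroup.nhds_eq, eventually_map]
  filter_upwards [Metric.ball_mem_nhds t (half_pos hε)] with s hs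
  rintro ⟨g, hg⟩
  refine hεU ?_
  have hg' := mem_ball_zero_iff.1 hg
  rw [Metric.mem_ball, dist_comm, dist_eq_norm] at hs
  calc ‖meanPrimitive g t - meanPrimitive g s‖ ≤ 2 * ‖g‖ * ‖t - s‖ :=
        norm_meanPrimitive_sub_le g t s
    _ ≤ 2 * 1 * ‖t - s‖ := by gcongr
    _ < ε := by linarith

/-! ### Scalar differential equations -/

theorem exists_eq_zero_deriv_nonpos {w w' : ℝ → ℝ} {a b : ℝ} (hab : a < b)
    (hw : ∀ t ∈ Set.Icc a b, HasDerivAt w (w' t) t) (ha : w a = 0) (hb : w b = 0) :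
    ∃ t ∈ Set.Icc a b, w t = 0 ∧ w' t ≤ 0 := by
  by_contra! hpos
  have hnonneg : ∀ t ∈ Set.Icc a b, -w t ≤ 0 := fun t ht =>
    image_le_of_deriv_right_lt_deriv_boundary (f := fun t => -w t) (f' := fun t => -w' t)
      (B := fun _ => 0) (B' := fun _ => 0)
      (fun s hs => (hw s hs).neg.continuousAt.continuousWithinAt)
      (fun s hs => (hw s (Set.Ico_subset_Icc_self hs)).neg.hasDerivWithinAt) (by simp [ha])
      (fun s => hasDerivAt_const s 0)
      (fun s hs hs' => neg_neg_of_pos (hpos s (Set.Ico_subset_Icc_self hs) (neg_eq_zero.1 hs'))) ht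
  have hslope : ∀ᶠ s in 𝓝[<] b, 0 < slope w b s :=
    ((hasDerivAt_iff_tendsto_slope.1 (hw b ⟨hab.le, le_rfl⟩)).mono_left
      (nhdsWithin_mono _ fun s hs => ne_of_lt hs)).eventually_const_lt
        (hpos b ⟨hab.le, le_rfl⟩ hb)
  obtain ⟨s, hs, hs'⟩ := (hslope.and (Ioo_mem_nhdsLT hab)).exists
  rw [slope_def_field, hb, sub_zero] at hs
  exact hs.not_ge (div_nonpos_of_nonneg_of_nonpos
    (neg_nonpos.1 (hnonneg s (Set.Ioo_subset_Icc_self hs'))) (sub_neg.2 hs'.2).le)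

section IntegratingFactor

/-- The integrating factor `exp ∫₀ᵗ a` of the equation `k' + a k = g`. -/
def integratingFactor (a : ℝ → ℝ) (t : ℝ) : ℝ :=
  Real.exp (∫ s in (0 : ℝ)..t, a s)

theorem integratingFactor_pos (a : ℝ → ℝ) (t : ℝ) : 0 < integratingFactor a t :=
  Real.exp_pos _

variable {a : ℝ → ℝ} (ha : Continuous a)
include ha

theorem hasDerivAt_integratingFactor (t : ℝ) :
    HasDerivAt (integratingFactor a) (integratingFactor a t * a t) t :=
  (ha.integral_hasStrictDerivAt 0 t).hasDerivAt.exp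

theorem hasDerivAt_integratingFactor_mul {k g : ℝ → ℝ} {t : ℝ}
    (hk : HasDerivAt k (g t - a t * k t) t) :
    HasDerivAt (fun t => integratingFactor a t * k t) (integratingFactor a t * g t) t :=
  ((hasDerivAt_integratingFactor ha t).mul hk).congr_deriv (by ring)

theorem pos_of_hasDerivAt_const_sub_mul {h : ℝ → ℝ} {c : ℝ}
    (hh : ∀ t, HasDerivAt h (c - a t * h t) t) (h0 : 0 < h 0) (h1 : 0 < h 1) {t : ℝ}
    (ht : t ∈ Set.Icc (0 : ℝ) 1) : 0 < h t := by
  have hd (t : ℝ) := hasDerivAt_integratingFactor_mul ha (g := fun _ => c) (hh t)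
  refine pos_of_mul_pos_right ?_ (integratingFactor_pos a t).le
  rcases le_total 0 c with hc | hc
  · refine (mul_pos (integratingFactor_pos a 0) h0).trans_le
      (monotone_of_hasDerivAt_nonneg hd (fun t => ?_) ht.1)
    exact mul_nonneg (integratingFactor_pos a t).le hc
  · refine (mul_pos (integratingFactor_pos a 1) h1).trans_le
      (antitone_of_hasDerivAt_nonpos hd (fun t => ?_) ht.2)
    exact mul_nonpos_of_nonneg_of_nonpos (integratingFactor_pos a t).le hc

theorem exists_forcing_pos {k g : ℝ → ℝ} (hg : Continuous g)
    (hk : ∀ t, HasDerivAt k (g t - a t * k t) t) (h0 : k 0 = 0) (h1 : k 1 = 0)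
    {t₀ : ℝ} (ht₀ : t₀ ∈ Set.Icc (0 : ℝ) 1) (hlt : g t₀ < 0) : ∃ t, 0 < g t := by
  by_contra! hle
  have hμ : Continuous (integratingFactor a) :=
    continuous_iff_continuousAt.2 fun t => (hasDerivAt_integratingFactor ha t).continuousAt
  have hint : ∫ t in (0 : ℝ)..1, integratingFactor a t * g t = 0 := by
    rw [intervalIntegral.integral_eq_sub_of_hasDerivAt
      (fun t _ => hasDerivAt_integratingFactor_mul ha (hk t)) ((hμ.mul hg).intervalIntegrable _ _)]
    simp [h0, h1]
  have hpos : 0 < ∫ t in (0 : ℝ)..1, -(integratingFactor a t * g t) :=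
    intervalIntegral.integral_pos zero_lt_one (hμ.mul hg).neg.continuousOn
      (fun t _ => neg_nonneg.2
        (mul_nonpos_of_nonneg_of_nonpos (integratingFactor_pos a t).le (hle t)))
      ⟨t₀, ht₀, neg_pos.2 (mul_neg_of_pos_of_neg (integratingFactor_pos a t₀) hlt)⟩
  rw [intervalIntegral.integral_neg, hint, neg_zero] at hpos
  exact hpos.false

end IntegratingFactor

theorem exists_meanPrimitive_eq_zero_le_mean (g : C0) :
    ∃ t, meanPrimitive g t = 0 ∧ g t ≤ mean g := by
  obtain ⟨t, -, ht, ht'⟩ := exists_eq_zero_deriv_nonpos zero_lt_one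
    (fun t _ => hasDerivAt_meanPrimitive g t) (meanPrimitive_apply_zero g)
    (meanPrimitive_apply_one g)
  exact ⟨t, ht, sub_nonpos.1 ht'⟩

theorem exists_meanPrimitive_eq_zero_mean_le (g : C0) :
    ∃ t, meanPrimitive g t = 0 ∧ mean g ≤ g t := by
  simpa using exists_meanPrimitive_eq_zero_le_mean (-g)

theorem eq_zero_of_eq_neg_meanPrimitive {w g : C0} {K : ℝ} (hw : w = -meanPrimitive g)
    (hK : ∀ t, |g t| ≤ K * |w t|) : w = 0 := by
  have hg (t) (ht : meanPrimitive g t = 0) : g t = 0 := by simpa [hw, ht] using hK t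
  have hmean : mean g = 0 := by
    obtain ⟨s, hs, hs'⟩ := exists_meanPrimitive_eq_zero_le_mean g
    obtain ⟨t, ht, ht'⟩ := exists_meanPrimitive_eq_zero_mean_le g
    exact le_antisymm (ht'.trans_eq (hg t ht)) ((hg s hs).symm.trans_le hs')
  have hd (t : ℝ) : HasDerivAt (fun s : ℝ => w s) (-g t) t := by
    simpa [hw, hmean] using! (hasDerivAt_meanPrimitive g t).neg
  ext x
  obtain ⟨t, ht, rfl⟩ := exists_coe_eq x
  exact eq_zero_of_abs_deriv_le_mul_abs_self_of_eq_zero_right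
    (fun s _ => (hd s).continuousAt.continuousWithinAt) (fun s _ => (hd s).hasDerivWithinAt)
    (by rw [hw, ContinuousMap.neg_apply, meanPrimitive_apply_zero, neg_zero])
    (fun s _ => by simpa using hK s) t ht

/-! ### Superposition operators -/

/-- The operator `u ↦ f(·, u(·))` on `C⁰`. -/
def superposition (f : C(UnitAddCircle × ℝ, ℝ)) (u : C0) : C0 :=
  f.comp ((ContinuousMap.id UnitAddCircle).prodMk u)

@[simp]
theorem superposition_apply (f : C(UnitAddCircle × ℝ, ℝ)) (u : C0) (t : UnitAddCircle) :
    superposition f u t = f (t, u t) :=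
  rfl

theorem continuous_superposition (f : C(UnitAddCircle × ℝ, ℝ)) :
    Continuous (superposition f) := by
  refine (ContinuousMap.continuous_postcomp f).comp ?_
  refine ContinuousMap.continuous_of_continuous_uncurry _ ?_
  exact continuous_snd.prodMk (continuous_eval.comp (continuous_fst.prodMk continuous_snd))

theorem SmoothOnCylinder.exists_hasDerivAt_snd {f : UnitAddCircle × ℝ → ℝ}
    (hf : SmoothOnCylinder f) :
    ∃ f' : C(UnitAddCircle × ℝ, ℝ), SmoothOnCylinder f' ∧
      ∀ t x, HasDerivAt (fun y => f (t, y)) (f' (t, x)) x := by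
  let F : ℝ × ℝ → ℝ := fun p => f ((p.1 : UnitAddCircle), p.2)
  have hd (t x : ℝ) : HasDerivAt (fun y => f (t, y)) (fderiv ℝ F (t, x) (0, 1)) x := by
    have hF : HasFDerivAt F (fderiv ℝ F (t, x)) (t, x) :=
      (hf.differentiable (by simp) (t, x)).hasFDerivAt
    have hline : HasDerivAt (fun y : ℝ => (t, y)) (0, 1) x :=
      (hasDerivAt_const x t).prodMk (hasDerivAt_id x)
    exact hF.comp_hasDerivAt x hline
  let f' : UnitAddCircle × ℝ → ℝ := fun p => deriv (fun y => f (p.1, y)) p.2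
  have hf' : SmoothOnCylinder f' := by
    have heq : (fun p : ℝ × ℝ => f' ((p.1 : UnitAddCircle), p.2)) =
        fun p => fderiv ℝ F p (0, 1) := funext fun p => (hd p.1 p.2).deriv
    unfold SmoothOnCylinder
    rw [heq]
    exact (hf.fderiv_right (m := ∞) (by simp)).clm_apply contDiff_const
  refine ⟨⟨f', ?_⟩, hf', fun t x => ?_⟩
  · exact (isOpenQuotientMap_coe.prodMap .id).isQuotientMap.continuous_iff.2 hf'.continuous
  · obtain ⟨t, -, rfl⟩ := exists_coe_eq t
    exact (hd t x).differentiableAt.hasDerivAt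

section HasDerivAt

variable {f f' : C(UnitAddCircle × ℝ, ℝ)}
  (hd : ∀ t x, HasDerivAt (fun y => f (t, y)) (f' (t, x)) x)
include hd

theorem hasFDerivAt_superposition (u : C0) :
    HasFDerivAt (superposition f) (ContinuousLinearMap.mul ℝ C0 (superposition f' u)) u := by
  rw [hasFDerivAt_iff_isLittleO_nhds_zero, Asymptotics.isLittleO_iff]
  intro ε hε
  obtain ⟨δ, hδ, hδε⟩ := Metric.continuous_iff.1 (continuous_superposition f') u ε hε
  filter_upwards [Metric.ball_mem_nhds (0 : C0) hδ] with h hh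
  rw [mem_ball_zero_iff] at hh
  refine (ContinuousMap.norm_le _ (by positivity)).2 fun t => ?_
  have hseg (τ : ℝ) : HasDerivAt (fun τ : ℝ => f (t, u t + τ * h t) - τ * (f' (t, u t) * h t))
      ((f' (t, u t + τ * h t) - f' (t, u t)) * h t) τ := by
    have hline : HasDerivAt (fun τ : ℝ => u t + τ * h t) (h t) τ :=
      (((hasDerivAt_id τ).mul_const (h t)).const_add (u t)).congr_deriv (one_mul _)
    exact (((hd t _).comp τ hline).sub ((hasDerivAt_id τ).mul_const _)).congr_deriv (by ring)
  have hbound : ∀ τ ∈ Set.Ico (0 : ℝ) 1,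
      ‖(f' (t, u t + τ * h t) - f' (t, u t)) * h t‖ ≤ ε * ‖h‖ := by
    intro τ hτ
    rw [norm_mul]
    refine mul_le_mul ?_ (h.norm_coe_le_norm t) (norm_nonneg _) hε.le
    have hclose : dist (u + τ • h) u < δ := by
      rw [dist_eq_norm, add_sub_cancel_left, norm_smul, Real.norm_of_nonneg hτ.1]
      exact (mul_le_of_le_one_left (norm_nonneg h) hτ.2.le).trans_lt hh
    exact ((superposition f' (u + τ • h) - superposition f' u).norm_coe_le_norm t).trans
      (dist_eq_norm (superposition f' (u + τ • h)) _ ▸ (hδε _ hclose).le)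
  have hincr := norm_image_sub_le_of_norm_deriv_le_segment_01'
    (fun τ _ => (hseg τ).hasDerivWithinAt) hbound
  refine le_trans (le_of_eq ?_) hincr
  congr 1
  simp only [ContinuousLinearMap.mul_apply', ContinuousMap.sub_apply, superposition_apply,
    ContinuousMap.add_apply, ContinuousMap.mul_apply, one_mul, zero_mul, add_zero, sub_zero]
  ring

theorem hasDerivAt_superposition_comp {U : ℝ → C0} {h : C0} {s : ℝ} (hU : HasDerivAt U h s) :
    HasDerivAt (fun s => superposition f (U s)) (superposition f' (U s) * h) s :=
  (hasFDerivAt_superposition hd (U s)).comp_hasDerivAt s hU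

end HasDerivAt

theorem contDiff_superposition {f : C(UnitAddCircle × ℝ, ℝ)} (hf : SmoothOnCylinder f) :
    ContDiff ℝ ∞ (superposition f) := by
  refine contDiff_infty.2 fun n => ?_
  induction n generalizing f with
  | zero => exact contDiff_zero.2 (continuous_superposition f)
  | succ n ih =>
    obtain ⟨f', hf', hd⟩ := hf.exists_hasDerivAt_snd
    have hmul : ContDiff ℝ n fun g : C0 => ContinuousLinearMap.mul ℝ C0 g := by fun_prop
    exact contDiff_succ_iff_hasFDerivAt.2
      ⟨fun u => ContinuousLinearMap.mul ℝ C0 (superposition f' u), hmul.comp (ih hf'),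
        hasFDerivAt_superposition hd⟩

theorem exists_norm_le_of_abs_le (f : C(UnitAddCircle × ℝ, ℝ)) (R : ℝ) :
    ∃ K, 0 ≤ K ∧ ∀ t x, |x| ≤ R → |f (t, x)| ≤ K := by
  obtain ⟨K, hK⟩ := ((isCompact_univ (X := UnitAddCircle)).prod
    (isCompact_Icc (a := -R) (b := R))).exists_bound_of_continuousOn f.continuous.continuousOn
  exact ⟨max K 0, le_max_right _ _, fun t x hx =>
    (hK (t, x) ⟨trivial, abs_le.1 hx⟩).trans (le_max_left _ _)⟩

/-! ### Coercivity -/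

theorem exists_lt_of_tendsto_cocompact {X : Type*} [TopologicalSpace X] {f : X × ℝ → ℝ}
    (hf : Tendsto f (cocompact (X × ℝ)) atTop) (M : ℝ) :
    ∃ R, ∀ t x, R ≤ |x| → M < f (t, x) := by
  obtain ⟨K, hK, hKM⟩ := mem_cocompact.1 (hf.eventually_gt_atTop M)
  obtain ⟨R, hR⟩ := (hK.image continuous_snd).isBounded.exists_norm_le
  refine ⟨R + 1, fun t x hx => hKM fun htx => ?_⟩
  have : |x| ≤ R := hR x ⟨(t, x), htx, rfl⟩
  linarith

theorem lt_of_tendsto_atTop_of_forall_ne {g : ℝ → ℝ} (hg : Continuous g)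
    (htop : Tendsto g atTop atTop) {x M : ℝ} (hne : ∀ y, x ≤ y → g y ≠ M) : M < g x := by
  by_contra! hle
  obtain ⟨y, hy, hxy⟩ := ((htop.eventually_ge_atTop M).and (eventually_ge_atTop x)).exists
  obtain ⟨z, hz, hzM⟩ := intermediate_value_Icc hxy hg.continuousOn ⟨hle, hy⟩
  exact hne z hz.1 hzM

theorem tendsto_cocompact_of_isProperMap {X : Type*} [TopologicalSpace X] [CompactSpace X]
    {f : X × ℝ → ℝ} (hproper : IsProperMap f)
    (htop : ∀ t, Tendsto (fun x : ℝ => f (t, x)) atTop atTop)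
    (hbot : ∀ t, Tendsto (fun x : ℝ => f (t, x)) atBot atTop) :
    Tendsto f (cocompact (X × ℝ)) atTop := by
  refine tendsto_atTop.2 fun M => ?_
  obtain ⟨R, hR⟩ := ((hproper.isCompact_preimage (isCompact_singleton (x := M))).image
    continuous_snd).isBounded.exists_norm_le
  have hne (t x) (hx : R < |x|) : f (t, x) ≠ M := fun h => hx.not_ge (hR x ⟨(t, x), h, rfl⟩)
  have hslice (t) : Continuous fun x => f (t, x) := hproper.continuous.comp (by fun_prop)
  filter_upwards [(isCompact_univ.prod (isCompact_Icc (a := -R) (b := R))).compl_mem_cocompact]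
  rintro ⟨t, x⟩ htx
  have hx : R < |x| := not_le.1 fun h => htx ⟨trivial, abs_le.1 h⟩
  rcases lt_abs.1 hx with hx | hx
  · exact (lt_of_tendsto_atTop_of_forall_ne (hslice t) (htop t)
      fun y hy => hne t y (lt_abs.2 (.inl (hx.trans_le hy)))).le
  · refine (lt_of_tendsto_atTop_of_forall_ne (g := fun y => f (t, -y)) (x := -x)
      ((hslice t).comp continuous_neg) ((hbot t).comp tendsto_neg_atTop_atBot)
      fun y hy => hne t (-y) (lt_abs.2 (.inr ?_))).le.trans_eq (by rw [neg_neg])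
    rw [neg_neg]
    exact hx.trans_le hy

/-! ### Straightening the equation -/

theorem exists_diffeomorph_of_isClosed_range {E F : Type*} [NormedAddCommGroup E]
    [NormedSpace ℝ E] [CompleteSpace E] [NormedAddCommGroup F] [NormedSpace ℝ F] {φ : E → F}
    (hφ : ContDiff ℝ ∞ φ) (hinj : Function.Injective φ) (hclosed : IsClosed (Set.range φ))
    (hderiv : ∀ u, ∃ T : E ≃L[ℝ] F, HasFDerivAt φ (T : E →L[ℝ] F) u) :
    ∃ Φ : E ≃ₘ[ℝ] F, ⇑Φ = φ := by
  choose T hT using hderiv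
  have hopen : IsOpenMap φ := isOpenMap_iff_nhds_le.2 fun u =>
    ((hφ.contDiffAt.hasStrictFDerivAt' (hT u) (by simp)).map_nhds_eq_of_equiv).ge
  have hsurj : Function.Surjective φ :=
    Set.range_eq_univ.1 (IsClopen.eq_univ ⟨hclosed, hopen.isOpen_range⟩ (Set.range_nonempty _))
  let e := (Equiv.ofBijective φ ⟨hinj, hsurj⟩).toHomeomorphOfContinuousOpen hφ.continuous hopen
  exact ⟨diffeomorphOfContDiff e.toEquiv hφ (e.contDiff_symm hT hφ), rfl⟩

theorem exists_equiv_id_add_meanPrimitive (a : C0) :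
    ∃ T : C0 ≃L[ℝ] C0,
      (T : C0 →L[ℝ] C0) = .id ℝ C0 + meanPrimitive ∘L ContinuousLinearMap.mul ℝ C0 a := by
  have hcomp : IsCompactOperator (meanPrimitive ∘L ContinuousLinearMap.mul ℝ C0 a) :=
    isCompactOperator_meanPrimitive.comp_clm _
  rcases hcomp.hasEigenvalue_or_mem_resolventSet (μ := (-1 : ℝ)) (by norm_num) with h | h
  · obtain ⟨w, hw⟩ := h.exists_hasEigenvector
    refine absurd (eq_zero_of_eq_neg_meanPrimitive (g := a * w) (K := ‖a‖) ?_ fun t => ?_) hw.2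
    · have heig : meanPrimitive (a * w) = (-1 : ℝ) • w := hw.apply_eq_smul
      rw [heig, neg_one_smul, neg_neg]
    · rw [ContinuousMap.mul_apply, abs_mul]
      exact mul_le_mul_of_nonneg_right (a.norm_coe_le_norm t) (abs_nonneg _)
  · rw [spectrum.mem_resolventSet_iff, ← IsUnit.neg_iff] at h
    obtain ⟨U, hU⟩ := h
    refine ⟨ContinuousLinearEquiv.unitsEquiv ℝ C0 U, ?_⟩
    ext w t
    have hUw := congrArg (fun S : C0 →L[ℝ] C0 => S w t) hU
    simpa [add_comm] using hUw

/-- The map `u ↦ u + Q f(·, u)` on `C⁰`, where `Q g` is the primitive of `g - ∫ g` vanishing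
at `0`: the integrated form of `u' + f(·, u)`, with the mean value dropped. -/
def straighten (f : C(UnitAddCircle × ℝ, ℝ)) (u : C0) : C0 :=
  u + meanPrimitive (superposition f u)

theorem contDiff_straighten {f : C(UnitAddCircle × ℝ, ℝ)} (hf : SmoothOnCylinder f) :
    ContDiff ℝ ∞ (straighten f) :=
  contDiff_id.add (meanPrimitive.contDiff.comp (contDiff_superposition hf))

theorem straighten_injective {f f' : C(UnitAddCircle × ℝ, ℝ)}
    (hd : ∀ t x, HasDerivAt (fun y => f (t, y)) (f' (t, x)) x) :
    Function.Injective (straighten f) := by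
  intro u v huv
  obtain ⟨K, -, hK⟩ := exists_norm_le_of_abs_le f' (max ‖u‖ ‖v‖)
  refine sub_eq_zero.1 (eq_zero_of_eq_neg_meanPrimitive (K := K)
    (g := superposition f u - superposition f v) ?_ fun t => ?_)
  · rw [map_sub, neg_sub, sub_eq_sub_iff_add_eq_add]
    exact huv.trans (add_comm _ _)
  · exact (convex_Icc (-max ‖u‖ ‖v‖) (max ‖u‖ ‖v‖)).norm_image_sub_le_of_norm_hasDerivWithin_le
      (fun x _ => (hd t x).hasDerivWithinAt) (fun x hx => hK t x (abs_le.2 hx))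
      (abs_le.1 ((v.norm_coe_le_norm t).trans (le_max_right _ _)))
      (abs_le.1 ((u.norm_coe_le_norm t).trans (le_max_left _ _)))

theorem exists_hasFDerivAt_straighten {f f' : C(UnitAddCircle × ℝ, ℝ)}
    (hd : ∀ t x, HasDerivAt (fun y => f (t, y)) (f' (t, x)) x) (u : C0) :
    ∃ T : C0 ≃L[ℝ] C0, HasFDerivAt (straighten f) (T : C0 →L[ℝ] C0) u := by
  obtain ⟨T, hT⟩ := exists_equiv_id_add_meanPrimitive (superposition f' u)
  exact ⟨T, hT ▸ (hasFDerivAt_id u).add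
    (meanPrimitive.hasFDerivAt.comp u (hasFDerivAt_superposition hd u))⟩

theorem exists_mean_superposition_le (f : C(UnitAddCircle × ℝ, ℝ)) (u : C0) :
    ∃ t, mean (superposition f u) ≤ f (t, straighten f u t) := by
  obtain ⟨t, ht, hle⟩ := exists_meanPrimitive_eq_zero_mean_le (superposition f u)
  exact ⟨t, by simpa [straighten, ht] using hle⟩

theorem exists_le_mean_superposition (f : C(UnitAddCircle × ℝ, ℝ)) (u : C0) :
    ∃ t, f (t, straighten f u t) ≤ mean (superposition f u) := by
  obtain ⟨t, ht, hle⟩ := exists_meanPrimitive_eq_zero_le_mean (superposition f u)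
  exact ⟨t, by simpa [straighten, ht] using hle⟩

theorem exists_norm_eq_isLocalExtr (g : C0) :
    ∃ t : ℝ, ‖g t‖ = ‖g‖ ∧ IsLocalExtr (fun s : ℝ => g s) t := by
  obtain ⟨x, -, hx⟩ := isCompact_univ.exists_isMaxOn Set.univ_nonempty
    (g.continuous.norm.continuousOn)
  obtain ⟨t, -, rfl⟩ := exists_coe_eq x
  have hmax (s : ℝ) : |g s| ≤ |g t| := hx (Set.mem_univ (s : UnitAddCircle))
  refine ⟨t, le_antisymm (g.norm_coe_le_norm _)
    ((ContinuousMap.norm_le _ (norm_nonneg _)).2 fun y => hx (Set.mem_univ y)), ?_⟩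
  rcases le_total 0 (g t) with h | h
  · exact .inr (.of_forall fun s => (le_abs_self _).trans ((hmax s).trans_eq (abs_of_nonneg h)))
  · exact .inl (.of_forall fun s =>
      neg_le_neg_iff.1 ((neg_le_abs _).trans ((hmax s).trans_eq (abs_of_nonpos h))))

section Coercive

variable {f : C(UnitAddCircle × ℝ, ℝ)} (hcoer : Tendsto f (cocompact (UnitAddCircle × ℝ)) atTop)
include hcoer

theorem exists_norm_le_of_norm_straighten_le (M : ℝ) :
    ∃ B, ∀ u, ‖straighten f u‖ ≤ M → ‖u‖ ≤ B := by
  obtain ⟨K, -, hK⟩ := exists_norm_le_of_abs_le f M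
  obtain ⟨R, hR⟩ := exists_lt_of_tendsto_cocompact hcoer K
  refine ⟨M + (R + M), fun u hu => ?_⟩
  have hy (t) : |straighten f u t| ≤ M := ((straighten f u).norm_coe_le_norm t).trans hu
  obtain ⟨r, hr⟩ := exists_mean_superposition_le f u
  have hmean : mean (superposition f u) ≤ K := hr.trans (le_of_abs_le (hK r _ (hy r)))
  obtain ⟨t, htnorm, htextr⟩ := exists_norm_eq_isLocalExtr (meanPrimitive (superposition f u))
  -- At an extremum of `Q f(·, u)` the value `f(t, u t)` is the mean, which bounds `u t`.
  have hcrit : f (t, u t) = mean (superposition f u) :=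
    sub_eq_zero.1 (htextr.hasDerivAt_eq_zero (hasDerivAt_meanPrimitive _ t))
  have hut : |u t| ≤ R := le_of_not_ge fun h => (hR t _ h).not_ge (hcrit.trans_le hmean)
  have hQ : meanPrimitive (superposition f u) = straighten f u - u := by simp [straighten]
  have hQnorm : ‖straighten f u - u‖ ≤ R + M := by
    rw [← hQ, ← htnorm, hQ, ContinuousMap.sub_apply, norm_sub_rev]
    exact (norm_sub_le _ _).trans (add_le_add hut (hy t))
  calc ‖u‖ = ‖straighten f u - (straighten f u - u)‖ := by rw [sub_sub_cancel]
    _ ≤ M + (R + M) := (norm_sub_le _ _).trans (add_le_add hu hQnorm)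

theorem isClosed_range_straighten : IsClosed (Set.range (straighten f)) := by
  have hcont : Continuous (straighten f) :=
    continuous_id.add (meanPrimitive.continuous.comp (continuous_superposition f))
  refine IsSeqClosed.isClosed fun y y₀ hy hlim => ?_
  choose u hu using hy
  obtain ⟨M, hM⟩ := (Metric.isBounded_range_of_tendsto y hlim).exists_norm_le
  obtain ⟨B, hB⟩ := exists_norm_le_of_norm_straighten_le hcoer M
  obtain ⟨K, hK0, hK⟩ := exists_norm_le_of_abs_le f B
  obtain ⟨S, hS, hKS⟩ := isCompactOperator_meanPrimitive.image_closedBall_subset_compact K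
  have hmem (n : ℕ) : meanPrimitive (superposition f (u n)) ∈ S := by
    refine hKS ⟨_, mem_closedBall_zero_iff.2 ((ContinuousMap.norm_le _ hK0).2 fun t => ?_), rfl⟩
    exact hK t _ (((u n).norm_coe_le_norm t).trans (hB _ (hu n ▸ hM _ ⟨n, rfl⟩)))
  obtain ⟨v, -, φ, hφ, hv⟩ := hS.tendsto_subseq hmem
  have hy' := hlim.comp hφ.tendsto_atTop
  have hu' : Tendsto (u ∘ φ) atTop (𝓝 (y₀ - v)) :=
    (hy'.sub hv).congr fun n => by simp [← hu, straighten]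
  exact ⟨y₀ - v, tendsto_nhds_unique ((hcont.tendsto _).comp hu')
    (hy'.congr fun n => (hu _).symm)⟩

theorem exists_diffeomorph_eq_straighten (hf : SmoothOnCylinder f) :
    ∃ Φ : C0 ≃ₘ[ℝ] C0, ⇑Φ = straighten f := by
  obtain ⟨f', -, hd⟩ := hf.exists_hasDerivAt_snd
  exact exists_diffeomorph_of_isClosed_range (contDiff_straighten hf) (straighten_injective hd)
    (isClosed_range_straighten hcoer) (exists_hasFDerivAt_straighten hd)

end Coercive

/-! ### The mean value along lines of the straightened equation -/

section LinearizedEquation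

variable {a g h k : C0} {t : ℝ}

theorem pos_of_add_meanPrimitive_eq_one (hh : h + meanPrimitive (a * h) = 1)
    (ht : t ∈ Set.Icc (0 : ℝ) 1) : 0 < h t := by
  have hval (x : UnitAddCircle) : h x = 1 - meanPrimitive (a * h) x :=
    congrArg (fun w : C0 => w x) (eq_sub_of_add_eq hh)
  have hderiv (t : ℝ) : HasDerivAt (fun t : ℝ => h t) (mean (a * h) - a t * h t) t := by
    simp only [hval]
    refine ((hasDerivAt_meanPrimitive (a * h) t).const_sub 1).congr_deriv ?_
    rw [neg_sub, ContinuousMap.mul_apply, hval]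
  refine pos_of_hasDerivAt_const_sub_mul (continuous_coe_comp a) hderiv ?_ ?_ ht
  · rw [hval, meanPrimitive_apply_zero, sub_zero]
    exact one_pos
  · rw [hval, meanPrimitive_apply_one, sub_zero]
    exact one_pos

theorem mean_pos_of_add_meanPrimitive_eq_zero (hk : k + meanPrimitive (g + a * k) = 0)
    (hg : ∀ t, 0 ≤ g t) (ht : t ∈ Set.Icc (0 : ℝ) 1) (hgt : 0 < g t) : 0 < mean (g + a * k) := by
  have hval (x : UnitAddCircle) : k x = -meanPrimitive (g + a * k) x :=
    congrArg (fun w : C0 => w x) (eq_neg_of_add_eq_zero_left hk)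
  have hderiv (t : ℝ) : HasDerivAt (fun t : ℝ => k t) (mean (g + a * k) - g t - a t * k t) t := by
    simp only [hval]
    refine (hasDerivAt_meanPrimitive (g + a * k) t).neg.congr_deriv ?_
    rw [ContinuousMap.add_apply, ContinuousMap.mul_apply, hval]
    ring
  by_contra! hle
  obtain ⟨r, hr⟩ := exists_forcing_pos (continuous_coe_comp a)
    (g := fun t : ℝ => mean (g + a * k) - g t)
    (continuous_const.sub (continuous_coe_comp g)) hderiv
    (by rw [hval, meanPrimitive_apply_zero, neg_zero])
    (by rw [hval, meanPrimitive_apply_one, neg_zero]) ht (by linarith)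
  linarith [hg r]

end LinearizedEquation

theorem D₂D₂_eq {f f₁ f₂ : C(UnitAddCircle × ℝ, ℝ)}
    (hd₁ : ∀ t x, HasDerivAt (fun y => f (t, y)) (f₁ (t, x)) x)
    (hd₂ : ∀ t x, HasDerivAt (fun y => f₁ (t, y)) (f₂ (t, x)) x) (t : UnitAddCircle) (x : ℝ) :
    D₂D₂ f t x = f₂ (t, x) := by
  have hderiv : deriv (fun y => f (t, y)) = fun y => f₁ (t, y) := funext fun y => (hd₁ t y).deriv
  rw [D₂D₂, iteratedDeriv_succ, iteratedDeriv_one, hderiv, (hd₂ t x).deriv]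

theorem hasDerivAt_add_meanPrimitive {u v : ℝ → C0} {u' v' : C0} {s : ℝ}
    (hu : HasDerivAt u u' s) (hv : HasDerivAt v v' s) :
    HasDerivAt (fun s => u s + meanPrimitive (v s)) (u' + meanPrimitive v') s :=
  hu.add (meanPrimitive.hasFDerivAt.comp_hasDerivAt s hv)

section Curve

variable {f : C(UnitAddCircle × ℝ, ℝ)} {U : ℝ → C0} {e : C0}
  (hline : ∀ s, straighten f (U s) = s • 1 + e)
include hline

theorem add_meanPrimitive_eq_one {f' : C(UnitAddCircle × ℝ, ℝ)}
    (hd : ∀ t x, HasDerivAt (fun y => f (t, y)) (f' (t, x)) x) {h : C0} {s : ℝ}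
    (hU : HasDerivAt U h s) : h + meanPrimitive (superposition f' (U s) * h) = 1 := by
  have hstraight : HasDerivAt (fun s => straighten f (U s))
      (h + meanPrimitive (superposition f' (U s) * h)) s :=
    hasDerivAt_add_meanPrimitive hU (hasDerivAt_superposition_comp hd hU)
  refine hstraight.unique ?_
  simp only [hline]
  exact (((hasDerivAt_id s).smul_const (1 : C0)).add_const e).congr_deriv (one_smul _ _)

theorem deriv_deriv_mean_superposition_pos (hf : SmoothOnCylinder f)
    (hconvex : ∀ t x, 0 ≤ D₂D₂ f t x) (hstrict : ∃ t, ∀ x, 0 < D₂D₂ f t x)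
    (hU : ContDiff ℝ ∞ U) (s : ℝ) :
    0 < deriv (deriv fun s => mean (superposition f (U s))) s := by
  obtain ⟨f₁, hf₁, hd₁⟩ := hf.exists_hasDerivAt_snd
  obtain ⟨f₂, -, hd₂⟩ := hf₁.exists_hasDerivAt_snd
  simp only [D₂D₂_eq hd₁ hd₂] at hconvex hstrict
  have hU₁ (s) : HasDerivAt U (deriv U s) s := (hU.differentiable (by simp) s).hasDerivAt
  have hU₂ (s) : HasDerivAt (deriv U) (deriv (deriv U) s) s :=
    (((contDiff_infty_iff_deriv.1 hU).2).differentiable (by simp) s).hasDerivAt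
  let g (s : ℝ) : C0 := superposition f₂ (U s) * deriv U s * deriv U s
  have hN₁ (s) : HasDerivAt (fun s => superposition f (U s))
      (superposition f₁ (U s) * deriv U s) s :=
    hasDerivAt_superposition_comp hd₁ (hU₁ s)
  have hN₂ (s) : HasDerivAt (fun s => superposition f₁ (U s) * deriv U s)
      (g s + superposition f₁ (U s) * deriv (deriv U) s) s :=
    (hasDerivAt_superposition_comp hd₂ (hU₁ s)).mul (hU₂ s)
  have heq₁ (s) : deriv U s + meanPrimitive (superposition f₁ (U s) * deriv U s) = 1 :=
    add_meanPrimitive_eq_one hline hd₁ (hU₁ s)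
  have heq₂ : deriv (deriv U) s +
      meanPrimitive (g s + superposition f₁ (U s) * deriv (deriv U) s) = 0 :=
    (hasDerivAt_add_meanPrimitive (hU₂ s) (hN₂ s)).unique
      ((hasDerivAt_const s (1 : C0)).congr_of_eventuallyEq (.of_forall heq₁))
  have hc₁ : deriv (fun s => mean (superposition f (U s))) =
      fun s => mean (superposition f₁ (U s) * deriv U s) :=
    funext fun s => (mean.hasFDerivAt.comp_hasDerivAt s (hN₁ s)).deriv
  have hc₂ : HasDerivAt (fun s => mean (superposition f₁ (U s) * deriv U s))
      (mean (g s + superposition f₁ (U s) * deriv (deriv U) s)) s :=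
    mean.hasFDerivAt.comp_hasDerivAt s (hN₂ s)
  rw [hc₁, hc₂.deriv]
  obtain ⟨x₀, hx₀⟩ := hstrict
  obtain ⟨t₀, ht₀, rfl⟩ := exists_coe_eq x₀
  have hpos : 0 < deriv U s t₀ := pos_of_add_meanPrimitive_eq_one (heq₁ s) ht₀
  refine mean_pos_of_add_meanPrimitive_eq_zero heq₂ (fun t => ?_) ht₀
    (mul_pos (mul_pos (hx₀ _) hpos) hpos)
  exact (mul_nonneg (hconvex t (U s t)) (mul_self_nonneg (deriv U s t))).trans_eq
    (mul_assoc _ _ _).symm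

theorem tendsto_mean_superposition (hcoer : Tendsto f (cocompact (UnitAddCircle × ℝ)) atTop) :
    Tendsto (fun s => mean (superposition f (U s))) (cocompact ℝ) atTop := by
  refine tendsto_atTop.2 fun M => ?_
  obtain ⟨R, hR⟩ := exists_lt_of_tendsto_cocompact hcoer M
  filter_upwards [tendsto_norm_cocompact_atTop.eventually_ge_atTop (R + ‖e‖)] with s hs
  obtain ⟨t, ht⟩ := exists_le_mean_superposition f (U s)
  rw [hline] at ht
  have hval : (s • 1 + e : C0) t = s + e t := by simp
  refine (hR t _ ?_).le.trans ht
  rw [hval]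
  have htriangle : |s| ≤ |s + e t| + |e t| := by simpa using abs_sub (s + e t) (e t)
  linarith [e.norm_coe_le_norm t, Real.norm_eq_abs s, Real.norm_eq_abs (e t)]

end Curve

/-! ### Global folds from convex fibres -/

theorem isGlobalFold_of_fst_convex {B₁ B₀ : Type*} [NormedAddCommGroup B₁] [NormedSpace ℝ B₁]
    [NormedAddCommGroup B₀] [NormedSpace ℝ B₀] {Z : Submodule ℝ B₀} [CompleteSpace Z]
    {G : B₁ → B₀} (L : B₁ ≃ₘ[ℝ] (ℝ × Z)) (M : B₀ ≃ₘ[ℝ] (ℝ × Z)) {c : ℝ × Z → ℝ}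
    (hG : ∀ p, M (G (L.symm p)) = (c p, p.2)) (hc : ContDiff ℝ ∞ c)
    (hpos : ∀ p, 0 < partialFst (partialFst c) p)
    (htop : ∀ z, Tendsto (fun s => c (s, z)) atTop atTop)
    (hbot : ∀ z, Tendsto (fun s => c (s, z)) atBot atTop) : IsGlobalFold Z G := by
  obtain ⟨m, X, hm, hX⟩ := exists_fold_coordinate hc hpos htop hbot
  let H : (ℝ × Z) ≃ₘ[ℝ] (ℝ × Z) := diffeomorphOfContDiff
    { toFun := fun p => (p.1 - m p.2, p.2)
      invFun := fun p => (p.1 + m p.2, p.2)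
      left_inv := fun p => by simp
      right_inv := fun p => by simp }
    ((contDiff_fst.sub (hm.comp contDiff_snd)).prodMk contDiff_snd)
    ((contDiff_fst.add (hm.comp contDiff_snd)).prodMk contDiff_snd)
  refine ⟨L.trans X, M.trans H, fun x v => ?_⟩
  obtain ⟨hsnd, hfst⟩ := hX (X.symm (x, v))
  rw [X.apply_symm_apply] at hsnd hfst
  change H (M (G (L.symm (X.symm (x, v))))) = (x ^ 2, v)
  rw [hG, hfst, ← hsnd]
  exact Prod.ext (add_sub_cancel_right _ _) rfl

section Coordinates

variable {f : C(UnitAddCircle × ℝ, ℝ)} (hf : SmoothOnCylinder f)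
  (hcoer : Tendsto f (cocompact (UnitAddCircle × ℝ)) atTop)
include hf hcoer

theorem exists_shear_diffeomorph {Z : Type*} [NormedAddCommGroup Z] [NormedSpace ℝ Z]
    (κ : Z →L[ℝ] C0) (j : C0 →L[ℝ] Z) (hj : ∀ g, κ (j g) = meanPrimitive g) :
    ∃ Y : (ℝ × Z) ≃ₘ[ℝ] (ℝ × Z),
      ∀ p, Y p = (p.1, p.2 + j (superposition f (p.1 • 1 + κ p.2))) := by
  obtain ⟨Φ, hΦ⟩ := exists_diffeomorph_eq_straighten hcoer hf
  let ι : ℝ × Z → C0 := fun p => p.1 • 1 + κ p.2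
  have hι : ContDiff ℝ ∞ ι :=
    (contDiff_fst.smul contDiff_const).add (κ.contDiff.comp contDiff_snd)
  let N (u : C0) : Z := j (superposition f u)
  have hN : ContDiff ℝ ∞ N := j.contDiff.comp (contDiff_superposition hf)
  have hfwd (p) : ι (p.1, p.2 + N (ι p)) = Φ (ι p) := by
    simp only [ι, N, map_add, hj, hΦ, straighten, add_assoc]
  have hbwd (p) : ι (p.1, p.2 - N (Φ.symm (ι p))) = Φ.symm (ι p) := by
    have hsol : Φ.symm (ι p) + κ (N (Φ.symm (ι p))) = ι p := by
      rw [hj]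
      exact (congrFun hΦ _).symm.trans (Φ.apply_symm_apply (ι p))
    simp only [ι, map_sub, ← add_sub_assoc, sub_eq_iff_eq_add]
    exact hsol.symm
  exact ⟨diffeomorphOfContDiff
    { toFun := fun p => (p.1, p.2 + N (ι p))
      invFun := fun p => (p.1, p.2 - N (Φ.symm (ι p)))
      left_inv := fun p => by simp [hfwd]
      right_inv := fun p => by simp [hbwd] }
    (contDiff_fst.prodMk (contDiff_snd.add (hN.comp hι)))
    (contDiff_fst.prodMk (contDiff_snd.sub (hN.comp (Φ.symm.contDiff.comp hι)))),
    fun _ => rfl⟩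

variable (hconvex : ∀ t x, 0 ≤ D₂D₂ f t x) (hstrict : ∃ t, ∀ x, 0 < D₂D₂ f t x)
  {B₁ B₀ : Type*} [NormedAddCommGroup B₁] [NormedSpace ℝ B₁] [NormedAddCommGroup B₀]
  [NormedSpace ℝ B₀] {Z : Submodule ℝ B₀} {G : B₁ → B₀}
include hconvex hstrict

theorem isGlobalFold_of_coordinates [CompleteSpace Z] (L : B₁ ≃L[ℝ] ℝ × Z) (M : B₀ ≃L[ℝ] ℝ × Z)
    (κ : Z →L[ℝ] C0) (j : C0 →L[ℝ] Z) (hj : ∀ g, κ (j g) = meanPrimitive g)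
    (hG : ∀ p, M (G (L.symm p)) = (mean (superposition f (p.1 • 1 + κ p.2)),
      p.2 + j (superposition f (p.1 • 1 + κ p.2)))) : IsGlobalFold Z G := by
  obtain ⟨Y, hY⟩ := exists_shear_diffeomorph hf hcoer κ j hj
  let U : ℝ × Z → C0 := fun p => (Y.symm p).1 • 1 + κ (Y.symm p).2
  have hU : ContDiff ℝ ∞ U :=
    (Y.symm.contDiff.fst.smul contDiff_const).add (κ.contDiff.comp Y.symm.contDiff.snd)
  have hYsymm (p) : ((Y.symm p).1, (Y.symm p).2 + j (superposition f (U p))) = p :=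
    (hY (Y.symm p)).symm.trans (Y.apply_symm_apply p)
  have hline (z : Z) (s : ℝ) : straighten f (U (s, z)) = s • 1 + κ z := by
    obtain ⟨hs, hz⟩ := Prod.ext_iff.1 (hYsymm (s, z))
    simp only at hs hz
    calc straighten f (U (s, z))
        = (Y.symm (s, z)).1 • 1 + κ ((Y.symm (s, z)).2 + j (superposition f (U (s, z)))) := by
          rw [straighten, ← hj, map_add, ← add_assoc]
      _ = s • 1 + κ z := by rw [hs, hz]
  have htends (z : Z) := tendsto_mean_superposition (hline z) hcoer
  refine isGlobalFold_of_fst_convex (c := fun p => mean (superposition f (U p)))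
    (L.toDiffeomorph.trans Y) M.toDiffeomorph (fun p => ?_)
    (mean.contDiff.comp ((contDiff_superposition hf).comp hU)) (fun p => ?_)
    (fun z => (htends z).mono_left atTop_le_cocompact)
    (fun z => (htends z).mono_left atBot_le_cocompact)
  · exact (hG (Y.symm p)).trans (congrArg (Prod.mk _) (congrArg Prod.snd (hYsymm p)))
  · exact deriv_deriv_mean_superposition_pos (hline p.2) hf hconvex hstrict
      (hU.comp (contDiff_id.prodMk contDiff_const)) p.1

theorem isGlobalFold_of_mean_splitting [CompleteSpace B₀] (i : C0 →L[ℝ] B₀) (ℓ : B₀ →L[ℝ] ℝ)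
    (P : B₀ →L[ℝ] C0) (hℓ : ∀ g, ℓ (i g) = mean g) (hP : ∀ g, P (i g) = meanPrimitive g)
    (hZ : ∀ v, v ∈ Z ↔ ℓ v = 0) (L : B₁ ≃L[ℝ] ℝ × Z)
    (hG : ∀ p, G (L.symm p) = p.2 + i (superposition f (p.1 • 1 + P p.2))) :
    IsGlobalFold Z G := by
  obtain rfl : Z = ℓ.ker := Submodule.ext hZ
  have hunit : Function.RightInverse (ContinuousLinearMap.toSpanSingleton ℝ (i 1)) ℓ :=
    fun x => by simp [hℓ, mean_one]
  refine isGlobalFold_of_coordinates hf hcoer hconvex hstrict L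
    (.equivOfRightInverse ℓ _ hunit) (P ∘L ℓ.ker.subtypeL)
    (ℓ.projKerOfRightInverse _ hunit ∘L i) (fun g => ?_) fun p => ?_
  · simp [hℓ, hP, meanPrimitive_one]
  · have hp : ℓ p.2 = 0 := p.2.2
    rw [hG]
    refine Prod.ext ?_ (Subtype.ext ?_) <;> simp [hp, hℓ]

end Coordinates

/-! ### Linear coordinates on `C¹` -/

theorem mem_C0Tilde_iff (v : C0) : v ∈ C0Tilde ↔ mean v = 0 := by
  rw [mean_apply]
  rfl

theorem C1.integral_eq (u : C1) (t : ℝ) :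
    ∫ s in (0 : ℝ)..t, u.1.2 s = u.1.1 t - u.1.1 ((0 : ℝ) : UnitAddCircle) :=
  intervalIntegral.integral_eq_sub_of_hasDerivAt (fun s _ => u.2 s)
    ((continuous_coe_comp u.1.2).intervalIntegrable _ _)

theorem C1.mean_deriv (u : C1) : mean u.1.2 = 0 := by
  rw [mean_apply, ← intervalIntegral_zero_one, C1.integral_eq, AddCircle.coe_period,
    ← QuotientAddGroup.mk_zero]
  exact sub_self _

theorem C1.eq_add_meanPrimitive (u : C1) :
    u.1.1 ((0 : ℝ) : UnitAddCircle) • 1 + meanPrimitive u.1.2 = u.1.1 := by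
  ext x
  obtain ⟨t, -, rfl⟩ := exists_coe_eq x
  rw [ContinuousMap.add_apply, meanPrimitive_coe, C1.mean_deriv, C1.integral_eq]
  simp

/-- The coordinates `u ↦ (u(0), u')` on `C¹`. -/
def C1.coordinates : C1 ≃L[ℝ] (ℝ × C0Tilde) :=
  .equivOfInverse
    (((ContinuousMap.evalCLM ℝ ((0 : ℝ) : UnitAddCircle)) ∘L .fst ℝ C0 C0 ∘L C1.subtypeL).prod
      ((.snd ℝ C0 C0 ∘L C1.subtypeL : C1 →L[ℝ] C0).codRestrict C0Tilde fun u =>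
        (mem_C0Tilde_iff _).2 (C1.mean_deriv u)))
    ((((ContinuousLinearMap.toSpanSingleton ℝ (1 : C0)).coprod
        (meanPrimitive ∘L C0Tilde.subtypeL)).prod
      (C0Tilde.subtypeL ∘L .snd ℝ ℝ C0Tilde)).codRestrict C1 fun p t => by
        have h := (hasDerivAt_meanPrimitive (p.2 : C0) t).const_add p.1
        rw [(mem_C0Tilde_iff _).1 p.2.2, sub_zero] at h
        simpa using! h)
    (fun u => Subtype.ext (Prod.ext (C1.eq_add_meanPrimitive u) rfl))
    fun p => by
      refine Prod.ext ?_ rfl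
      change (p.1 • (1 : C0) + meanPrimitive p.2) ((0 : ℝ) : UnitAddCircle) = p.1
      rw [ContinuousMap.add_apply, meanPrimitive_apply_zero]
      simp

theorem isGlobalFold_opC {f : C(UnitAddCircle × ℝ, ℝ)} (hf : SmoothOnCylinder f)
    (hcoer : Tendsto f (cocompact (UnitAddCircle × ℝ)) atTop)
    (hconvex : ∀ t x, 0 ≤ D₂D₂ f t x) (hstrict : ∃ t, ∀ x, 0 < D₂D₂ f t x) :
    IsGlobalFold C0Tilde (opC f) :=
  isGlobalFold_of_mean_splitting hf hcoer hconvex hstrict (.id ℝ C0) mean meanPrimitive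
    (fun _ => rfl) (fun _ => rfl) mem_C0Tilde_iff C1.coordinates fun _ => rfl

/-! ### Linear coordinates on `H¹` -/

/-- The inclusion of `L²` into `L¹`. -/
def H0.toL1 : H0 →L[ℝ] Lp ℝ 1 (volume : Measure UnitAddCircle) :=
  LinearMap.mkContinuous
    { toFun v := ((Lp.memLp v).mono_exponent one_le_two).toLp v
      map_add' v w := by
        rw [← MemLp.toLp_add]
        exact MemLp.toLp_congr _ _ (Lp.coeFn_add v w)
      map_smul' c v := by
        rw [RingHom.id_apply, ← MemLp.toLp_const_smul]
        exact MemLp.toLp_congr _ _ (Lp.coeFn_smul c v) } 1 fun v => by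
    have : IsProbabilityMeasure (volume : Measure UnitAddCircle) := ⟨UnitAddCircle.measure_univ⟩
    rw [one_mul]
    change ‖((Lp.memLp v).mono_exponent one_le_two).toLp v‖ ≤ ‖v‖
    rw [Lp.norm_toLp, Lp.norm_def]
    exact ENNReal.toReal_mono (Lp.eLpNorm_ne_top v)
      (eLpNorm_le_eLpNorm_of_exponent_le one_le_two (Lp.aestronglyMeasurable v))

theorem H0.coeFn_toL1 (v : H0) : H0.toL1 v =ᵐ[volume] v :=
  MemLp.coeFn_toLp ((Lp.memLp v).mono_exponent one_le_two)

/-- The inclusion of `C⁰` into `L²`. -/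
def C0.toH0 : C0 →L[ℝ] H0 :=
  ContinuousMap.toLp 2 volume ℝ

theorem C0.coeFn_toH0 (g : C0) : C0.toH0 g =ᵐ[volume] g :=
  ContinuousMap.coeFn_toLp volume g

theorem H0.toL1_toH0 (g : C0) : H0.toL1 (C0.toH0 g) = ContinuousMap.toLp 1 volume ℝ g :=
  Lp.ext ((H0.coeFn_toL1 _).trans ((C0.coeFn_toH0 g).trans
    (ContinuousMap.coeFn_toLp volume g).symm))

/-- The mean value on `L²`. -/
def H0.mean : H0 →L[ℝ] ℝ :=
  L1.integralCLM ∘L H0.toL1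

theorem H0.mean_apply (v : H0) : H0.mean v = ∫ t, v t := by
  rw [H0.mean, ContinuousLinearMap.comp_apply, ← L1.integral_eq, L1.integral_eq_integral]
  exact integral_congr_ae (H0.coeFn_toL1 v)

theorem H0.mean_toH0 (g : C0) : H0.mean (C0.toH0 g) = PeriodicODE.mean g := by
  rw [H0.mean, ContinuousLinearMap.comp_apply, H0.toL1_toH0]
  rfl

theorem mem_H0Tilde_iff (v : H0) : v ∈ H0Tilde ↔ H0.mean v = 0 := by
  rw [H0.mean_apply]
  rfl

/-- The primitive, vanishing at `0`, of the mean-free part of a square integrable function. -/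
def H0.primitive : H0 →L[ℝ] C0 :=
  PeriodicODE.primitive ∘L H0.toL1

theorem H0.primitive_toH0 (g : C0) : H0.primitive (C0.toH0 g) = meanPrimitive g := by
  rw [H0.primitive, ContinuousLinearMap.comp_apply, H0.toL1_toH0]
  rfl

theorem H0.primitive_coe (v : H0) {t : ℝ} (ht : t ∈ Set.Icc (0 : ℝ) 1) :
    H0.primitive v t = (∫ s in (0 : ℝ)..t, v s) - t * H0.mean v := by
  rw [H0.primitive, ContinuousLinearMap.comp_apply, primitive_apply, primitiveFun_coe,
    H0.integral_congr (H0.coeFn_toL1 v) ht, integral_congr_ae (H0.coeFn_toL1 v), H0.mean_apply]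

theorem H1.mean_snd (u : H1) : H0.mean u.1.snd = 0 := by
  obtain ⟨U, -, hU⟩ := u.2
  have h := hU 1 (by simp)
  rw [intervalIntegral_zero_one, AddCircle.coe_period, ← QuotientAddGroup.mk_zero,
    left_eq_add] at h
  rw [H0.mean_apply, h]

theorem H1.exists_fst_eq (u : H1) : ∃ a : ℝ, u.1.fst = C0.toH0 (a • 1 + H0.primitive u.1.snd) := by
  obtain ⟨U, hU, hU'⟩ := u.2
  refine ⟨U ((0 : ℝ) : UnitAddCircle), Lp.ext (hU.trans ?_)⟩
  refine EventuallyEq.trans (Eventually.of_forall fun x => ?_) (C0.coeFn_toH0 _).symm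
  obtain ⟨t, ht, rfl⟩ := exists_coe_eq x
  rw [hU' t ht, ContinuousMap.add_apply, H0.primitive_coe _ ht, H1.mean_snd]
  simp

/-- The value at `0` of the continuous representative of an element of `H¹`, as the bounded
functional `(u, u') ↦ ∫ u - ∫ H0.primitive u'`. -/
def H1.evalZero : WithLp 2 (H0 × H0) →L[ℝ] ℝ :=
  H0.mean ∘L WithLp.fstL 2 ℝ H0 H0 - mean ∘L H0.primitive ∘L WithLp.sndL 2 ℝ H0 H0

theorem H1.evalZero_eq {p : WithLp 2 (H0 × H0)} {a : ℝ}
    (h : p.fst = C0.toH0 (a • 1 + H0.primitive p.snd)) : H1.evalZero p = a := by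
  change H0.mean p.fst - mean (H0.primitive p.snd) = a
  rw [h, H0.mean_toH0, map_add, map_smul, mean_one]
  simp

theorem H1.fst_eq (u : H1) :
    C0.toH0 (H1.evalZero u.1 • 1 + H0.primitive u.1.snd) = u.1.fst := by
  obtain ⟨a, ha⟩ := H1.exists_fst_eq u
  rw [H1.evalZero_eq ha, ← ha]

/-- The element of `H¹` with given value at `0` and given derivative. -/
def H1.ofCoordinates : ℝ × H0Tilde →L[ℝ] WithLp 2 (H0 × H0) :=
  (WithLp.prodContinuousLinearEquiv 2 ℝ H0 H0).symm.toContinuousLinearMap ∘L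
    ((C0.toH0 ∘L ((ContinuousLinearMap.toSpanSingleton ℝ (1 : C0)).coprod
        (H0.primitive ∘L H0Tilde.subtypeL))).prod
      (H0Tilde.subtypeL ∘L .snd ℝ ℝ H0Tilde))

theorem H1.fst_ofCoordinates (p : ℝ × H0Tilde) :
    (H1.ofCoordinates p).fst = C0.toH0 (p.1 • 1 + H0.primitive p.2) :=
  rfl

theorem H1.snd_ofCoordinates (p : ℝ × H0Tilde) : (H1.ofCoordinates p).snd = p.2 :=
  rfl

theorem H1.ofCoordinates_mem (p : ℝ × H0Tilde) : H1.ofCoordinates p ∈ H1 := by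
  refine ⟨p.1 • 1 + H0.primitive p.2, ?_, fun t ht => ?_⟩
  · rw [H1.fst_ofCoordinates]
    exact C0.coeFn_toH0 _
  · rw [ContinuousMap.add_apply, ContinuousMap.add_apply, H0.primitive_coe _ ht,
      H0.primitive_coe _ (by simp), (mem_H0Tilde_iff _).1 p.2.2, H1.snd_ofCoordinates]
    simp

/-- The coordinates `u ↦ (u(0), u')` on `H¹`. -/
def H1.coordinates : H1 ≃L[ℝ] (ℝ × H0Tilde) :=
  .equivOfInverse
    ((H1.evalZero ∘L H1.subtypeL).prod
      ((WithLp.sndL 2 ℝ H0 H0 ∘L H1.subtypeL : H1 →L[ℝ] H0).codRestrict H0Tilde fun u =>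
        (mem_H0Tilde_iff _).2 (H1.mean_snd u)))
    (H1.ofCoordinates.codRestrict H1 H1.ofCoordinates_mem)
    (fun u => Subtype.ext (WithLp.ofLp_injective 2 (Prod.ext (H1.fst_eq u) rfl)))
    fun p => Prod.ext (H1.evalZero_eq (H1.fst_ofCoordinates p)) rfl

theorem opH_ofCoordinates (f : C(UnitAddCircle × ℝ, ℝ)) (p : ℝ × H0Tilde) :
    opH f (H1.coordinates.symm p) =
      p.2 + C0.toH0 (superposition f (p.1 • 1 + H0.primitive p.2)) := by
  change (p.2 : H0) + MemLp.toLp _ _ = _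
  congr 1
  refine Lp.ext ((MemLp.coeFn_toLp _).trans (EventuallyEq.trans ?_ (C0.coeFn_toH0 _).symm))
  filter_upwards [C0.coeFn_toH0 (p.1 • 1 + H0.primitive p.2)] with t ht
  exact congrArg (fun x => f (t, x)) ht

theorem isGlobalFold_opH {f : C(UnitAddCircle × ℝ, ℝ)} (hf : SmoothOnCylinder f)
    (hcoer : Tendsto f (cocompact (UnitAddCircle × ℝ)) atTop)
    (hconvex : ∀ t x, 0 ≤ D₂D₂ f t x) (hstrict : ∃ t, ∀ x, 0 < D₂D₂ f t x) :
    IsGlobalFold H0Tilde (opH f) :=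
  isGlobalFold_of_mean_splitting hf hcoer hconvex hstrict C0.toH0 H0.mean H0.primitive
    H0.mean_toH0 H0.primitive_toH0 mem_H0Tilde_iff H1.coordinates (opH_ofCoordinates f)

end PeriodicODE

end

theorem theorem4p2_general (f : C(UnitAddCircle × ℝ, ℝ))
    (hsmooth : PeriodicODE.SmoothOnCylinder f)
    (hcoer : Tendsto f (cocompact (UnitAddCircle × ℝ)) atTop)
    (hconvex : ∀ t x, 0 ≤ PeriodicODE.D₂D₂ f t x)
    (hstrict : ∃ t, ∀ x, 0 < PeriodicODE.D₂D₂ f t x) :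
    PeriodicODE.IsGlobalFold PeriodicODE.C0Tilde (PeriodicODE.opC f) ∧
      PeriodicODE.IsGlobalFold PeriodicODE.H0Tilde (PeriodicODE.opH f) :=
  ⟨PeriodicODE.isGlobalFold_opC hsmooth hcoer hconvex hstrict,
    PeriodicODE.isGlobalFold_opH hsmooth hcoer hconvex hstrict⟩

theorem theorem4p2 (f : C(UnitAddCircle × ℝ, ℝ))
    (hsmooth : PeriodicODE.SmoothOnCylinder f)
    (hproper : IsProperMap f)
    (htop : ∀ t : UnitAddCircle, Tendsto (fun x : ℝ => f (t, x)) atTop atTop)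
    (hbot : ∀ t : UnitAddCircle, Tendsto (fun x : ℝ => f (t, x)) atBot atTop)
    (hconvex : ∀ (t : UnitAddCircle) (x : ℝ), 0 < PeriodicODE.D₂D₂ f t x) :
    PeriodicODE.IsGlobalFold PeriodicODE.C0Tilde (PeriodicODE.opC f) ∧
      PeriodicODE.IsGlobalFold PeriodicODE.H0Tilde (PeriodicODE.opH f) :=
  theorem4p2_general f hsmooth (PeriodicODE.tendsto_cocompact_of_isProperMap hproper htop hbot)
    (fun t x => (hconvex t x).le) ⟨0, hconvex 0⟩
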